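/- Let $0<m\le L$ and $\alpha,\beta,\eta\in\mathbb{R}$. For a differentiable $f:\mathbb{R}^d\to\mathbb{R}$ consider the algorithm $$y_k = x_k+\eta(x_k-x_{k-1}),\qquad u_k=\nabla f(y_k),\qquad x_{k+1}=x_k+\beta(x_k-x_{k-1})-\alpha u_k\qquad(k\ge 0)$$ with initial conditions $x_0,x_{-1}\in\mathbb{R}^d$, and let $$g(z)=-\alpha\,\frac{(1+\eta)z-\eta}{(z-1)(z-\beta)}$$ be its transfer function from $u$ to $y$. Assume that the algorithm's realization of $g$ has no hidden mode on or outside the unit circle, i.e. $\alpha\neq0$, and $|\beta|<1$ in case $\eta=\beta(1+\eta)$ (this holds in particular whenever the realization is minimal). For a sequence $(h_k)_{k\in\mathbb{Z}}$ of reals with $h_k\ge0$ for all $k$ and $\|h\|_1=\sum_{k\in\mathbb{Z}}|h_k|\le1$, put $h(z)=\sum_{k\in\mathbb{Z}}h_kz^{-k}$ for $|z|=1$ and $$\Pi_{m,L}=\begin{bmatrix}-mL(2-h-h^*) & L(1-h^*)+m(1-h)\\ L(1-h)+m(1-h^*) & -(2-h-h^*)\end{bmatrix}.$$ Suppose that the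 rational function $\bigl(1-\tfrac{L+m}{2}g(z)\bigr)^{-1}$ is stable (proper, with all its poles in the open unit disk) and that, for some such $h$, the frequency-domain inequality $$\begin{bmatrix}g(z)\\1\end{bmatrix}^*\Pi_{m,L}(z)\begin{bmatrix}g(z)\\1\end{bmatrix}<0$$ holds for all $z$ with $|z|=1$ that are not poles of $g$. Then for every $d$ and every $f:\mathbb{R}^d\to\mathbb{R}$ that is $m$-strongly convex and differentiable with $L$-Lipschitz gradient, $f$ has a unique minimizer $x_\star$, and the algorithm is globally asymptotically stable: $(x_\star,x_\star)$ is a Lyapunov stable equilibrium of the iteration $(x_k,x_{k-1})\mapsto(x_{k+1},x_k)$, and $x_k\to x_\star$ for all initial conditions $x_0,x_{-1}\in\mathbb{R}^d$. -/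

import Mathlib

open Filter Topology
open scoped Matrix Gradient

noncomputable section

namespace GradAlg

/-- The class of `m`-strongly convex functions on `ℝᵈ` whose gradient is `L`-Lipschitz. -/
structure SmoothStronglyConvex {d : ℕ} (m L : ℝ) (f : EuclideanSpace ℝ (Fin d) → ℝ) : Prop where
  differentiable : Differentiable ℝ f
  lipschitz_gradient : ∀ x y, ‖∇ f x - ∇ f y‖ ≤ L * ‖x - y‖
  strongConvex : StrongConvexOn Set.univ m f

/-- One step `(x_k, x_{k-1}) ↦ (x_{k+1}, x_k)` of the algorithm
`y_k = x_k + η (x_k - x_{k-1})`, `u_k = ∇ f (y_k)`,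
`x_{k+1} = x_k + β (x_k - x_{k-1}) - α u_k`. -/
def step {d : ℕ} (α β η : ℝ) (f : EuclideanSpace ℝ (Fin d) → ℝ)
    (p : EuclideanSpace ℝ (Fin d) × EuclideanSpace ℝ (Fin d)) :
    EuclideanSpace ℝ (Fin d) × EuclideanSpace ℝ (Fin d) :=
  let y := p.1 + η • (p.1 - p.2)
  let u := ∇ f y
  (p.1 + β • (p.1 - p.2) - α • u, p.1)

/-- Global asymptotic stability of the point `p` for the discrete-time system `q_{k+1} = T q_k`:
`p` is an equilibrium, it is Lyapunov stable, and every trajectory converges to it. -/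
structure GloballyAsymptoticallyStable {X : Type*} [PseudoMetricSpace X] (T : X → X) (p : X) :
    Prop where
  equilibrium : T p = p
  stable : ∀ ε > 0, ∃ δ > 0, ∀ q, dist q p < δ → ∀ k : ℕ, dist (T^[k] q) p < ε
  attractive : ∀ q, Tendsto (fun k : ℕ => T^[k] q) atTop (𝓝 p)

/-- The transfer function `g(z) = -α ((1 + η) z - η) / ((z - 1) (z - β))`. -/
def transferFunction (α β η : ℝ) : RatFunc ℂ :=
  -RatFunc.C (α : ℂ) * (RatFunc.C (1 + η : ℂ) * RatFunc.X - RatFunc.C (η : ℂ)) /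
    ((RatFunc.X - 1) * (RatFunc.X - RatFunc.C (β : ℂ)))

/-- A discrete-time transfer function is stable if it is proper and all its poles (the roots of
the denominator in lowest terms) lie in the open unit disk. -/
structure IsStable (F : RatFunc ℂ) : Prop where
  proper : F.num.natDegree ≤ F.denom.natDegree
  poles : ∀ z : ℂ, F.denom.IsRoot z → ‖z‖ < 1

/-- Impulse responses `(h_k)`, `k ∈ ℤ`, with `h_k ≥ 0` and `‖h‖₁ ≤ 1`. -/
structure IsZamesFalb (h : ℤ → ℝ) : Prop where
  nonneg : ∀ k, 0 ≤ h k
  summable : Summable fun k => |h k|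
  norm_le_one : ∑' k, |h k| ≤ 1

/-- The transfer function `h(z) = ∑ h_k z^{-k}` of the impulse response `(h_k)`. -/
def zTransform (h : ℤ → ℝ) (z : ℂ) : ℂ := ∑' k : ℤ, (h k : ℂ) * z ^ (-k)

/-- The O'Shea–Zames–Falb multiplier `Π_{m,L}(z)` built from `h`. -/
def multiplier (m L : ℝ) (h : ℤ → ℝ) (z : ℂ) : Matrix (Fin 2) (Fin 2) ℂ :=
  let H := zTransform h z
  !![-(m * L) * (2 - H - star H), L * (1 - star H) + m * (1 - H);
     L * (1 - H) + m * (1 - star H), -(2 - H - star H)]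

/-- The frequency-domain inequality `[g; 1]* Π_{m,L} [g; 1] < 0` on the unit circle, required
wherever `g` is finite, i.e. at all points that are not poles of `g`. The left-hand side is real,
since `Π_{m,L}(z)` is Hermitian. -/
def FDI (m L : ℝ) (h : ℤ → ℝ) (g : RatFunc ℂ) : Prop :=
  ∀ z : ℂ, ‖z‖ = 1 → ¬ g.denom.IsRoot z →
    (star ![g.eval (RingHom.id ℂ) z, 1] ⬝ᵥ
      (multiplier m L h z *ᵥ ![g.eval (RingHom.id ℂ) z, 1])).re < 0

end GradAlg

end

/-!
After the transformation `(y, u) ↦ (L y - u, u - m y)` the gradient is a cyclically monotone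
relation, so that summing `⟪u_k - m y_k, (L y_k - u_k) - (L y_{k-j} - u_{k-j})⟫` over `k` gives a
nonnegative number. Averaging over `j` with the weights `h_j` yields the O'Shea–Zames–Falb
inequality for square-summable signals. Subtracting the strict frequency-domain inequality, read
through Parseval's identity, bounds every square-summable trajectory by its input, with a constant
that does not depend on the gradient. The line segment from the linear gain `κ y`, where stability
is a matter of roots, to the gradient stays in the class, and the uniform bound propagates
square-summability along it in small steps. An initial condition is an input supported at two
times, so the deviation from the minimizer is square-summable and bounded by its initial value.
-/

namespace GradAlg

section QuadraticBounds

variable {E : Type*} [NormedAddCommGroup E] [InnerProductSpace ℝ E]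
  {m L κ t M : ℝ} {F F₁ F₂ : E → ℝ} {G G₁ G₂ : E → E}

/-- `F` lies between the quadratic models of curvature `m` and `L` built on the field `G`, which is
then its gradient. This encodes membership in the class of `m`-strongly convex functions with
`L`-Lipschitz gradient by inequalities that are visibly stable under convex combinations. -/
structure QuadraticBounds (m L : ℝ) (F : E → ℝ) (G : E → E) : Prop where
  lower : ∀ a b, F b + inner ℝ (G b) (a - b) + m / 2 * ‖a - b‖ ^ 2 ≤ F a
  upper : ∀ a b, F a ≤ F b + inner ℝ (G b) (a - b) + L / 2 * ‖a - b‖ ^ 2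

lemma half_mul_norm_sq_eq (κ : ℝ) (a b : E) :
    κ / 2 * ‖a‖ ^ 2 = κ / 2 * ‖b‖ ^ 2 + inner ℝ (κ • b) (a - b) + κ / 2 * ‖a - b‖ ^ 2 := by
  rw [norm_sub_sq_real, real_inner_smul_left, inner_sub_right, real_inner_self_eq_norm_sq,
    real_inner_comm]
  ring

namespace QuadraticBounds

lemma quadratic (hm : m ≤ κ) (hL : κ ≤ L) :
    QuadraticBounds m L (fun x : E => κ / 2 * ‖x‖ ^ 2) (fun x => κ • x) := by
  constructor <;> intro a b <;> rw [half_mul_norm_sq_eq κ a b] <;> gcongr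

lemma combination (h₁ : QuadraticBounds m L F₁ G₁) (h₂ : QuadraticBounds m L F₂ G₂)
    (ht₀ : 0 ≤ t) (ht₁ : t ≤ 1) :
    QuadraticBounds m L (fun x => (1 - t) * F₁ x + t * F₂ x)
      (fun x => (1 - t) • G₁ x + t • G₂ x) := by
  have ht : 0 ≤ 1 - t := sub_nonneg.2 ht₁
  constructor <;> intro a b <;> simp only [inner_add_left, real_inner_smul_left]
  · linarith [mul_le_mul_of_nonneg_left (h₁.lower a b) ht,
      mul_le_mul_of_nonneg_left (h₂.lower a b) ht₀]
  · linarith [mul_le_mul_of_nonneg_left (h₁.upper a b) ht,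
      mul_le_mul_of_nonneg_left (h₂.upper a b) ht₀]

lemma translate (h : QuadraticBounds m L F G) (c : E) :
    QuadraticBounds m L (fun x => F (c + x)) (fun x => G (c + x)) where
  lower a b := by simpa only [add_sub_add_left_eq_sub] using h.lower (c + a) (c + b)
  upper a b := by simpa only [add_sub_add_left_eq_sub] using h.upper (c + a) (c + b)

lemma sub_quadratic (h : QuadraticBounds m L F G) (κ : ℝ) :
    QuadraticBounds (m - κ) (L - κ) (fun x => F x - κ / 2 * ‖x‖ ^ 2) (fun x => G x - κ • x) := by
  constructor <;> intro a b <;> rw [half_mul_norm_sq_eq κ a b, inner_sub_left]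
  · linarith [h.lower a b]
  · linarith [h.upper a b]

lemma mul_norm_sub_sq_le_inner (h : QuadraticBounds m L F G) (a b : E) :
    m * ‖a - b‖ ^ 2 ≤ inner ℝ (G a - G b) (a - b) := by
  have hab := h.lower a b
  have hba := h.lower b a
  rw [← neg_sub a b, inner_neg_right, norm_neg] at hba
  rw [inner_sub_left]
  linarith

lemma lt_of_eq_zero (h : QuadraticBounds m L F G) (hm : 0 < m) {a b : E} (hb : G b = 0)
    (hab : a ≠ b) : F b < F a := by
  have hlow := h.lower a b
  rw [hb, inner_zero_left, add_zero] at hlow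
  have : 0 < ‖a - b‖ := norm_pos_iff.2 (sub_ne_zero.2 hab)
  exact (lt_add_of_pos_right _ (by positivity)).trans_le hlow

lemma norm_sub_sq_le (h : QuadraticBounds 0 M F G) (hM : 0 ≤ M) (a b : E) :
    ‖G a - G b‖ ^ 2 / 2 ≤ M * (F b - F a - inner ℝ (G a) (b - a)) := by
  set D := ‖G a - G b‖ ^ 2 with hD
  set C := F b - F a - inner ℝ (G a) (b - a)
  -- Compare the lower model at `a` with the upper model at `b` at the points `b + t (G a - G b)`.
  have hquad : ∀ t : ℝ, 0 ≤ M * D / 2 * (t * t) + -D * t + C := fun t => by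
    have hlow := h.lower (b + t • (G a - G b)) a
    have hupp := h.upper (b + t • (G a - G b)) b
    rw [add_sub_right_comm, inner_add_right, real_inner_smul_right] at hlow
    rw [add_sub_cancel_left, real_inner_smul_right, norm_smul, mul_pow, Real.norm_eq_abs,
      sq_abs] at hupp
    have hinner : inner ℝ (G a) (G a - G b) - inner ℝ (G b) (G a - G b) = D := by
      rw [← inner_sub_left, real_inner_self_eq_norm_sq]
    linear_combination hlow + hupp - t * hinner
  have hdiscrim := discrim_le_zero hquad
  rw [discrim] at hdiscrim
  have hC₀ : 0 ≤ C := by simpa using hquad 0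
  rcases (sq_nonneg ‖G a - G b‖).eq_or_lt with hD₀ | hD₀
  · rw [hD, ← hD₀, zero_div]
    exact mul_nonneg hM hC₀
  · refine le_of_mul_le_mul_left ?_ hD₀
    linarith

end QuadraticBounds

/-- The potential whose differences bound the pairing of `G - m` with the increments of `L - G`,
see `QuadraticBounds.storage_sub_le`. -/
noncomputable def storage (m L : ℝ) (F : E → ℝ) (G : E → E) (a : E) : ℝ :=
  (L - m) * (F a - m / 2 * ‖a‖ ^ 2) - ‖G a - m • a‖ ^ 2 / 2

lemma QuadraticBounds.storage_sub_le (hmL : m ≤ L) (h : QuadraticBounds m L F G) (a b : E) :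
    storage m L F G a - storage m L F G b
      ≤ inner ℝ (G a - m • a) ((L • a - G a) - (L • b - G b)) := by
  have hshift := h.sub_quadratic m
  rw [sub_self] at hshift
  have key := hshift.norm_sub_sq_le (sub_nonneg.2 hmL) a b
  have hincr : L • a - G a - (L • b - G b)
      = (L - m) • (a - b) - ((G a - m • a) - (G b - m • b)) := by module
  rw [hincr, ← neg_sub a b, norm_sub_sq_real, inner_neg_right] at *
  rw [storage, storage, inner_sub_right, inner_sub_right, real_inner_smul_right,
    real_inner_self_eq_norm_sq]
  linarith

end QuadraticBounds

section Gradient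

variable {E : Type*} [NormedAddCommGroup E] [InnerProductSpace ℝ E] [CompleteSpace E]
  {m L : ℝ} {f : E → ℝ}

lemma hasDerivAt_comp_lineMap (hf : Differentiable ℝ f) (a b : E) (t : ℝ) :
    HasDerivAt (f ∘ AffineMap.lineMap a b) (inner ℝ (∇ f (AffineMap.lineMap a b t)) (b - a)) t :=
  (hf _).hasGradientAt.hasFDerivAt.comp_hasDerivAt t AffineMap.hasDerivAt_lineMap

lemma le_add_inner_gradient (hf : Differentiable ℝ f)
    (hL : ∀ x y, ‖∇ f x - ∇ f y‖ ≤ L * ‖x - y‖) (a b : E) :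
    f a ≤ f b + inner ℝ (∇ f b) (a - b) + L / 2 * ‖a - b‖ ^ 2 := by
  let model : ℝ → ℝ := fun t => f b + t * inner ℝ (∇ f b) (a - b) + t ^ 2 * (L / 2 * ‖a - b‖ ^ 2)
  have hmodel : ∀ t, HasDerivAt model (inner ℝ (∇ f b) (a - b) + t * (L * ‖a - b‖ ^ 2)) t :=
    fun t => ((((hasDerivAt_id t).mul_const _).const_add (f b)).add
      ((hasDerivAt_pow 2 t).mul_const (L / 2 * ‖a - b‖ ^ 2))).congr_deriv (by norm_num; ring)
  have hslope : ∀ t ∈ Set.Ico (0 : ℝ) 1, inner ℝ (∇ f (AffineMap.lineMap b a t)) (a - b)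
      ≤ inner ℝ (∇ f b) (a - b) + t * (L * ‖a - b‖ ^ 2) := fun t ht => by
    have hline : ‖AffineMap.lineMap b a t - b‖ = t * ‖a - b‖ := by
      rw [AffineMap.lineMap_apply_module', add_sub_cancel_right, norm_smul,
        Real.norm_of_nonneg ht.1]
    have hgrad := hL (AffineMap.lineMap b a t) b
    rw [hline] at hgrad
    rw [← sub_le_iff_le_add', ← inner_sub_left]
    calc _ ≤ ‖∇ f (AffineMap.lineMap b a t) - ∇ f b‖ * ‖a - b‖ := real_inner_le_norm _ _
      _ ≤ L * (t * ‖a - b‖) * ‖a - b‖ := by gcongr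
      _ = t * (L * ‖a - b‖ ^ 2) := by ring
  have hle := image_le_of_deriv_right_le_deriv_boundary (f := f ∘ AffineMap.lineMap b a)
    (fun t _ => (hasDerivAt_comp_lineMap hf b a t).continuousAt.continuousWithinAt)
    (fun t _ => (hasDerivAt_comp_lineMap hf b a t).hasDerivWithinAt)
    (by simp [model]) (fun t _ => (hmodel t).continuousAt.continuousWithinAt)
    (fun t _ => (hmodel t).hasDerivWithinAt) hslope (Set.right_mem_Icc.2 zero_le_one)
  simpa [model] using hle

lemma add_inner_gradient_le (hf : Differentiable ℝ f) (hc : ConvexOn ℝ Set.univ f) (a b : E) :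
    f b + inner ℝ (∇ f b) (a - b) ≤ f a := by
  have hline : ConvexOn ℝ Set.univ (f ∘ AffineMap.lineMap b a) :=
    hc.comp_affineMap (AffineMap.lineMap b a)
  have hslope := hline.le_slope_of_hasDerivAt (Set.mem_univ 0) (Set.mem_univ 1) zero_lt_one
    (hasDerivAt_comp_lineMap hf b a 0)
  rw [AffineMap.lineMap_apply_zero, slope_def_field, Function.comp_apply, Function.comp_apply,
    AffineMap.lineMap_apply_one, AffineMap.lineMap_apply_zero, sub_zero, div_one] at hslope
  linarith

lemma hasGradientAt_sub_quadratic (hf : Differentiable ℝ f) (m : ℝ) (x : E) :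
    HasGradientAt (fun x => f x - m / 2 * ‖x‖ ^ 2) (∇ f x - m • x) x := by
  rw [hasGradientAt_iff_hasFDerivAt]
  refine ((hf x).hasGradientAt.hasFDerivAt.sub
    ((hasStrictFDerivAt_norm_sq x).hasFDerivAt.const_mul (m / 2))).congr_fderiv ?_
  ext v
  simp only [toDual_gradient, sub_apply, smul_apply, coe_innerSL_apply, nsmul_eq_mul,
    Nat.cast_ofNat, smul_eq_mul, map_sub, map_smul, InnerProductSpace.toDual_apply_apply,
    sub_right_inj]
  ring

lemma add_inner_gradient_add_le (hf : Differentiable ℝ f) (hc : StrongConvexOn Set.univ m f)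
    (a b : E) : f b + inner ℝ (∇ f b) (a - b) + m / 2 * ‖a - b‖ ^ 2 ≤ f a := by
  have hsub := add_inner_gradient_le
    (fun x => (hasGradientAt_sub_quadratic hf m x).differentiableAt)
    (strongConvexOn_iff_convex.1 hc) a b
  rw [(hasGradientAt_sub_quadratic hf m b).gradient, half_mul_norm_sq_eq m a b,
    inner_sub_left] at hsub
  linarith

lemma quadraticBounds_gradient (hf : Differentiable ℝ f)
    (hL : ∀ x y, ‖∇ f x - ∇ f y‖ ≤ L * ‖x - y‖) (hc : StrongConvexOn Set.univ m f) :
    QuadraticBounds m L f (∇ f) :=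
  ⟨add_inner_gradient_add_le hf hc, le_add_inner_gradient hf hL⟩

lemma exists_eq_zero_of_strongly_monotone {G : E → E} (hm : 0 < m) (hL : 0 < L)
    (hmono : ∀ a b, m * ‖a - b‖ ^ 2 ≤ inner ℝ (G a - G b) (a - b))
    (hlip : ∀ a b, ‖G a - G b‖ ≤ L * ‖a - b‖) : ∃ x, G x = 0 := by
  set τ := m / L ^ 2
  have hτ₀ : 0 < τ := by positivity
  have hdist : ∀ a b, ‖(a - τ • G a) - (b - τ • G b)‖ ^ 2 ≤ (1 - τ * m) * ‖a - b‖ ^ 2 := by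
    intro a b
    have hsq : ‖G a - G b‖ ^ 2 ≤ L ^ 2 * ‖a - b‖ ^ 2 := by
      rw [← mul_pow]
      gcongr
      exact hlip a b
    have hτL : τ * L ^ 2 = m := div_mul_cancel₀ m (by positivity)
    calc ‖(a - τ • G a) - (b - τ • G b)‖ ^ 2 = ‖(a - b) - τ • (G a - G b)‖ ^ 2 := by
          congr 2; module
      _ = ‖a - b‖ ^ 2 - 2 * τ * inner ℝ (G a - G b) (a - b) + τ ^ 2 * ‖G a - G b‖ ^ 2 := by
          rw [norm_sub_sq_real, real_inner_smul_right, norm_smul, mul_pow, Real.norm_eq_abs,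
            sq_abs, real_inner_comm]
          ring
      _ ≤ ‖a - b‖ ^ 2 - 2 * τ * (m * ‖a - b‖ ^ 2) + τ ^ 2 * (L ^ 2 * ‖a - b‖ ^ 2) := by
          gcongr
          exact hmono a b
      _ = (1 - τ * m) * ‖a - b‖ ^ 2 := by
          linear_combination τ * ‖a - b‖ ^ 2 * hτL
  have hcontr : ContractingWith (√(1 - τ * m)).toNNReal fun x => x - τ • G x := by
    refine ⟨?_, LipschitzWith.of_dist_le_mul fun a b => ?_⟩
    · rw [Real.toNNReal_lt_one, Real.sqrt_lt' one_pos]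
      nlinarith [mul_pos hτ₀ hm]
    · rw [dist_eq_norm, dist_eq_norm, Real.coe_toNNReal _ (Real.sqrt_nonneg _),
        ← Real.sqrt_sq (norm_nonneg (a - b)), ← Real.sqrt_mul' _ (sq_nonneg _)]
      exact Real.le_sqrt_of_sq_le (hdist a b)
  refine ⟨hcontr.fixedPoint _, ?_⟩
  have hfix : _ - τ • G _ = _ := hcontr.fixedPoint_isFixedPt
  rw [sub_eq_self, smul_eq_zero] at hfix
  exact hfix.resolve_left hτ₀.ne'

end Gradient

section SquareSummable

lemma memℓp_two_iff {ι F : Type*} [NormedAddCommGroup F] {x : ι → F} :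
    Memℓp x 2 ↔ Summable fun k => ‖x k‖ ^ 2 := by
  simp [memℓp_gen_iff]

lemma hasSum_norm_sq {ι F : Type*} [NormedAddCommGroup F] (x : lp (fun _ : ι => F) 2) :
    HasSum (fun k => ‖x k‖ ^ 2) (‖x‖ ^ 2) := by
  simpa using lp.hasSum_norm (p := 2) (by norm_num) x

variable {E : Type*} [NormedAddCommGroup E]

/-- Square-summable two-sided sequences in `E`. -/
abbrev SeqL2 (E : Type*) [NormedAddCommGroup E] : Type _ := lp (fun _ : ℤ => E) 2

lemma memℓp_two_comp_sub (n : ℤ) {x : ℤ → E} (hx : Memℓp x 2) :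
    Memℓp (fun k => x (k - n)) 2 :=
  memℓp_two_iff.2 ((memℓp_two_iff.1 hx).comp_injective sub_left_injective)

lemma memℓp_two_of_forall_le {C : ℝ} {x : ℤ → E}
    (h : ∀ N : ℕ, ∃ X : SeqL2 E, ‖X‖ ≤ C ∧ ∀ k ≤ (N : ℤ), X k = x k) : Memℓp x 2 := by
  refine memℓp_two_iff.2 (summable_of_sum_le (c := C ^ 2) (fun k => sq_nonneg _) fun s => ?_)
  obtain ⟨N, hN⟩ := s.bddAbove
  obtain ⟨X, hXle, hXeq⟩ := h N.toNat
  calc ∑ k ∈ s, ‖x k‖ ^ 2 = ∑ k ∈ s, ‖X k‖ ^ 2 :=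
        Finset.sum_congr rfl fun k hk => by rw [hXeq k ((hN hk).trans N.self_le_toNat)]
    _ ≤ ‖X‖ ^ 2 := sum_le_hasSum s (fun k _ => sq_nonneg _) (hasSum_norm_sq X)
    _ ≤ C ^ 2 := by gcongr

variable [InnerProductSpace ℝ E]

/-- The shift `(S_n x)_k = x_{k-n}` on square-summable sequences. -/
noncomputable def shift (n : ℤ) : SeqL2 E →ₗᵢ[ℝ] SeqL2 E where
  toFun x := ⟨fun k => x (k - n), memℓp_two_comp_sub n (lp.memℓp x)⟩
  map_add' _ _ := rfl
  map_smul' _ _ := rfl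
  norm_map' x := by
    rw [lp.norm_eq_tsum_rpow (by norm_num), lp.norm_eq_tsum_rpow (by norm_num)]
    exact congrArg (· ^ _) ((Equiv.subRight n).tsum_eq fun k => ‖x k‖ ^ (2 : ENNReal).toReal)

@[simp] lemma shift_apply (n : ℤ) (x : SeqL2 E) (k : ℤ) : shift n x k = x (k - n) := rfl

lemma shift_single (n k : ℤ) (v : E) :
    shift n (lp.single 2 k v : SeqL2 E) = lp.single 2 (k + n) v := by
  ext j
  simp only [shift_apply, lp.single_apply, Pi.single_apply, sub_eq_iff_eq_add]

lemma inner_shift_left (n : ℤ) (x y : SeqL2 E) :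
    inner ℝ (shift n x) y = inner ℝ x (shift (-n) y) := by
  have hinv : shift n (shift (-n) y) = y := by
    ext k
    simp only [shift_apply, sub_neg_eq_add, sub_add_cancel]
  rw [← (shift n).inner_map_map x, hinv]

end SquareSummable

section LaurentPolynomial

open LaurentPolynomial

variable {E : Type*} [NormedAddCommGroup E] [InnerProductSpace ℝ E]

/-- Laurent polynomials acting on square-summable sequences, `T n` being the shift by `n`. -/
noncomputable def laurentAct (E : Type*) [NormedAddCommGroup E] [InnerProductSpace ℝ E] :
    ℝ[T;T⁻¹] →ₐ[ℝ] (SeqL2 E →L[ℝ] SeqL2 E) :=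
  AddMonoidAlgebra.lift ℝ (SeqL2 E →L[ℝ] SeqL2 E) ℤ
    { toFun := fun n => (shift n.toAdd).toContinuousLinearMap
      map_one' := by ext x k; simp
      map_mul' := fun a b => by ext x k; simp [sub_sub] }

@[simp] lemma laurentAct_T (n : ℤ) (x : SeqL2 E) : laurentAct E (T n) x = shift n x := by
  rw [T, laurentAct, AddMonoidAlgebra.lift_single, one_smul]
  rfl

@[simp] lemma laurentAct_C (c : ℝ) (x : SeqL2 E) : laurentAct E (C c) x = c • x := by
  rw [C_eq_algebraMap, AlgHom.commutes]
  rfl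

lemma laurentAct_mul_apply (P Q : ℝ[T;T⁻¹]) (x : SeqL2 E) :
    laurentAct E (P * Q) x = laurentAct E P (laurentAct E Q x) := by
  rw [map_mul, mul_apply_eq_comp]

lemma inner_laurentAct_left (P : ℝ[T;T⁻¹]) (x y : SeqL2 E) :
    inner ℝ (laurentAct E P x) y = inner ℝ x (laurentAct E (invert P) y) := by
  induction P using LaurentPolynomial.induction_on' with
  | add p q hp hq =>
    simp only [map_add, _root_.add_apply, inner_add_left, inner_add_right, hp, hq]
  | C_mul_T n a =>
    simp only [map_mul, invert_C, invert_T, mul_apply_eq_comp, laurentAct_C,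
      laurentAct_T, real_inner_smul_left, real_inner_smul_right, inner_shift_left]

/-- Evaluation of a Laurent polynomial on the unit circle. As `T n` acts as the delay by `n`, its
symbol is `z⁻ⁿ`. -/
noncomputable def laurentEval (z : Circle) : ℝ[T;T⁻¹] →+* ℂ :=
  eval₂ Complex.ofRealHom (Circle.toUnits z⁻¹)

@[simp] lemma laurentEval_T (z : Circle) (n : ℤ) : laurentEval z (T n) = (z : ℂ) ^ (-n) := by
  rw [laurentEval, eval₂_T, Units.val_zpow_eq_zpow_val, Circle.toUnits_apply, Units.val_mk0,
    Circle.coe_inv, inv_zpow']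

@[simp] lemma laurentEval_C (z : Circle) (c : ℝ) : laurentEval z (C c) = c :=
  eval₂_C _ _ c

lemma laurentEval_invert (z : Circle) (P : ℝ[T;T⁻¹]) :
    laurentEval z (invert P) = star (laurentEval z P) := by
  have hz : star (z : ℂ) = (z : ℂ)⁻¹ := (Circle.coe_inv_eq_conj z).symm.trans (Circle.coe_inv z)
  induction P using LaurentPolynomial.induction_on' with
  | add p q hp hq => simp only [map_add, hp, hq, star_add]
  | C_mul_T n a =>
    rw [map_mul, invert_C, invert_T, map_mul, map_mul, star_mul', laurentEval_C, laurentEval_T,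
      laurentEval_T, star_zpow₀, hz, inv_zpow', neg_neg, Complex.star_def, Complex.conj_ofReal]

lemma continuous_circle_zpow (n : ℤ) : Continuous fun z : Circle => (z : ℂ) ^ n :=
  continuous_subtype_val.zpow₀ n fun z => Or.inl (Circle.coe_ne_zero z)

lemma continuous_laurentEval (P : ℝ[T;T⁻¹]) : Continuous fun z => laurentEval z P := by
  induction P using LaurentPolynomial.induction_on' with
  | add p q hp hq =>
    simp only [map_add]
    exact Continuous.add hp hq
  | C_mul_T n a =>
    simp only [map_mul, laurentEval_C, laurentEval_T]
    exact continuous_const.mul (continuous_circle_zpow (-n))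

end LaurentPolynomial

section Parseval

open MeasureTheory LaurentPolynomial

variable {E : Type*} [NormedAddCommGroup E] [InnerProductSpace ℝ E]

/-- The squared norm of the trigonometric polynomial `∑ k ∈ s, zᵏ v_k` with coefficients in `E`.
Splitting `zᵏ` into real and imaginary parts avoids the complexification of `E`. -/
noncomputable def energy (s : Finset ℤ) (v : ℤ → E) (z : Circle) : ℝ :=
  ‖∑ k ∈ s, ((z : ℂ) ^ k).re • v k‖ ^ 2 + ‖∑ k ∈ s, ((z : ℂ) ^ k).im • v k‖ ^ 2

lemma energy_nonneg (s : Finset ℤ) (v : ℤ → E) (z : Circle) : 0 ≤ energy s v z := by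
  unfold energy
  positivity

lemma circle_zpow_sub (z : Circle) (k l : ℤ) :
    (z : ℂ) ^ (k - l) = (z : ℂ) ^ k * star ((z : ℂ) ^ l) := by
  have hz : star (z : ℂ) = (z : ℂ)⁻¹ := (Circle.coe_inv_eq_conj z).symm.trans (Circle.coe_inv z)
  rw [zpow_sub₀ (Circle.coe_ne_zero z), star_zpow₀, hz, inv_zpow, div_eq_mul_inv]

lemma energy_eq_sum (s : Finset ℤ) (v : ℤ → E) (z : Circle) :
    (energy s v z : ℂ)
      = ∑ k ∈ s, ∑ l ∈ s, ((inner ℝ (v k) (v l) : ℝ) : ℂ) * (z : ℂ) ^ (k - l) := by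
  simp only [circle_zpow_sub]
  apply Complex.ext
  · simp only [energy, ← real_inner_self_eq_norm_sq, sum_inner, inner_sum, real_inner_smul_left,
      real_inner_smul_right, Complex.ofReal_re, Complex.re_sum, Complex.re_ofReal_mul,
      ← Finset.sum_add_distrib]
    refine Finset.sum_congr rfl fun k _ => Finset.sum_congr rfl fun l _ => ?_
    rw [Complex.mul_re, Complex.star_def, Complex.conj_re, Complex.conj_im, real_inner_comm]
    ring
  · simp only [Complex.ofReal_im, Complex.im_sum, Complex.im_ofReal_mul]
    refine (self_eq_neg.1 (Finset.sum_comm.trans ?_)).symm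
    simp only [← Finset.sum_neg_distrib]
    refine Finset.sum_congr rfl fun k _ => Finset.sum_congr rfl fun l _ => ?_
    simp only [Complex.mul_im, Complex.star_def, Complex.conj_re, Complex.conj_im,
      real_inner_comm (v k)]
    ring

lemma integral_circleExp_zpow (n : ℤ) :
    ∫ θ in (0 : ℝ)..(2 * Real.pi), (Circle.exp θ : ℂ) ^ n = if n = 0 then 2 * Real.pi else 0 := by
  split_ifs with hn
  · simp [hn]
  · have hexp : ∀ θ : ℝ, (Circle.exp θ : ℂ) ^ n = Complex.exp (n * Complex.I * θ) := fun θ => by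
      rw [Circle.coe_exp, ← Complex.exp_int_mul, mul_comm (θ : ℂ), mul_assoc]
    have hperiod : (n * Complex.I * (2 * Real.pi : ℝ) : ℂ) = n * (2 * Real.pi * Complex.I) := by
      push_cast
      ring
    simp_rw [hexp]
    rw [integral_exp_mul_complex (by simp [hn]), hperiod, Complex.exp_int_mul_two_pi_mul_I]
    simp

lemma continuous_energy (s : Finset ℤ) (v : ℤ → E) : Continuous (energy s v) := by
  have hre := fun n => Complex.continuous_re.comp (continuous_circle_zpow n)
  have him := fun n => Complex.continuous_im.comp (continuous_circle_zpow n)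
  exact (continuous_finsetSum s fun k _ => (hre k).smul continuous_const).norm.pow 2 |>.add
    ((continuous_finsetSum s fun k _ => (him k).smul continuous_const).norm.pow 2)

lemma laurentEval_monomial_mul_energy (s : Finset ℤ) (v : ℤ → E) (a : ℝ) (n : ℤ) (z : Circle) :
    laurentEval z (C a * T n) * (energy s v z : ℂ)
      = ∑ k ∈ s, ∑ l ∈ s, ((a * inner ℝ (v k) (v l) : ℝ) : ℂ) * (z : ℂ) ^ (k - (l + n)) := by
  rw [energy_eq_sum, map_mul, laurentEval_C, laurentEval_T, Finset.mul_sum]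
  refine Finset.sum_congr rfl fun k _ => ?_
  rw [Finset.mul_sum]
  refine Finset.sum_congr rfl fun l _ => ?_
  rw [← sub_sub, sub_eq_add_neg (k - l), zpow_add₀ (Circle.coe_ne_zero z), Complex.ofReal_mul]
  ring

lemma inner_sum_single_shift (s : Finset ℤ) (v : ℤ → E) (n : ℤ) :
    inner ℝ (∑ k ∈ s, lp.single 2 k (v k) : SeqL2 E) (shift n (∑ l ∈ s, lp.single 2 l (v l)))
      = ∑ k ∈ s, ∑ l ∈ s, if k = l + n then inner ℝ (v k) (v l) else 0 := by
  simp only [map_sum, shift_single, sum_inner, inner_sum, lp.inner_single_left, lp.single_apply,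
    Pi.single_apply, apply_ite (inner ℝ _), inner_zero_right]
  exact Finset.sum_comm

theorem integral_laurentEval_mul_energy (s : Finset ℤ) (v : ℤ → E) (P : ℝ[T;T⁻¹]) :
    ∫ θ in (0 : ℝ)..(2 * Real.pi),
        laurentEval (Circle.exp θ) P * (energy s v (Circle.exp θ) : ℂ)
      = 2 * Real.pi * ((inner ℝ (∑ k ∈ s, lp.single 2 k (v k) : SeqL2 E)
          (laurentAct E P (∑ k ∈ s, lp.single 2 k (v k))) : ℝ) : ℂ) := by
  induction P using LaurentPolynomial.induction_on' with
  | add p q hp hq =>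
    have hint : ∀ R : ℝ[T;T⁻¹], IntervalIntegrable (fun θ : ℝ => laurentEval (Circle.exp θ) R
        * (energy s v (Circle.exp θ) : ℂ)) volume 0 (2 * Real.pi) := fun R =>
      (((continuous_laurentEval R).mul (Complex.continuous_ofReal.comp
        (continuous_energy s v))).comp (map_continuous Circle.exp)).intervalIntegrable _ _
    simp only [map_add, _root_.add_apply, inner_add_right, add_mul, Complex.ofReal_add, mul_add]
    rw [intervalIntegral.integral_add (hint p) (hint q), hp, hq]
  | C_mul_T n a =>
    have hcont : ∀ (c : ℂ) (j : ℤ), Continuous fun θ : ℝ => c * (Circle.exp θ : ℂ) ^ j :=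
      fun c j => continuous_const.mul
        ((continuous_circle_zpow j).comp (map_continuous Circle.exp))
    simp only [laurentEval_monomial_mul_energy, laurentAct_mul_apply, laurentAct_C, laurentAct_T,
      real_inner_smul_right, inner_sum_single_shift]
    rw [intervalIntegral.integral_finsetSum fun k _ =>
        (continuous_finsetSum s fun l _ => hcont _ _).intervalIntegrable _ _, Finset.mul_sum,
      Complex.ofReal_sum, Finset.mul_sum]
    refine Finset.sum_congr rfl fun k _ => ?_
    rw [intervalIntegral.integral_finsetSum fun l _ => (hcont _ _).intervalIntegrable _ _,
      Finset.mul_sum, Complex.ofReal_sum, Finset.mul_sum]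
    refine Finset.sum_congr rfl fun l _ => ?_
    simp only [intervalIntegral.integral_const_mul, integral_circleExp_zpow, sub_eq_zero]
    split_ifs <;> push_cast <;> ring

lemma inner_laurentAct_sum_single_nonneg {P : ℝ[T;T⁻¹]}
    (hP : ∀ z : Circle, 0 ≤ (laurentEval z P).re) (s : Finset ℤ) (v : ℤ → E) :
    0 ≤ inner ℝ (∑ k ∈ s, lp.single 2 k (v k) : SeqL2 E)
      (laurentAct E P (∑ k ∈ s, lp.single 2 k (v k))) := by
  have hparseval := congrArg Complex.re (integral_laurentEval_mul_energy s v P)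
  have hcont : Continuous fun θ : ℝ =>
      laurentEval (Circle.exp θ) P * (energy s v (Circle.exp θ) : ℂ) :=
    ((continuous_laurentEval P).mul (Complex.continuous_ofReal.comp
      (continuous_energy s v))).comp (map_continuous Circle.exp)
  have hre := Complex.reCLM.intervalIntegral_comp_comm
    (hcont.intervalIntegrable (μ := volume) 0 (2 * Real.pi))
  rw [← Complex.reCLM_apply, ← hre] at hparseval
  have hnonneg : 0 ≤ ∫ θ in (0 : ℝ)..(2 * Real.pi), Complex.reCLM
      (laurentEval (Circle.exp θ) P * (energy s v (Circle.exp θ) : ℂ)) :=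
    intervalIntegral.integral_nonneg (by positivity) fun θ _ => by
      rw [Complex.reCLM_apply, Complex.re_mul_ofReal]
      exact mul_nonneg (hP _) (energy_nonneg _ _ _)
  rw [hparseval, ← Complex.ofReal_ofNat, ← Complex.ofReal_mul, ← Complex.ofReal_mul,
    Complex.ofReal_re] at hnonneg
  exact nonneg_of_mul_nonneg_right hnonneg (by positivity)

lemma inner_laurentAct_nonneg {P : ℝ[T;T⁻¹]} (hP : ∀ z : Circle, 0 ≤ (laurentEval z P).re)
    (x : SeqL2 E) : 0 ≤ inner ℝ x (laurentAct E P x) := by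
  have hcont : Continuous fun y : SeqL2 E => inner ℝ y (laurentAct E P y) := by fun_prop
  have hlim := (hcont.tendsto x).comp (lp.hasSum_single (by norm_num) x)
  exact ge_of_tendsto' hlim fun s => inner_laurentAct_sum_single_nonneg hP s x

lemma mul_norm_sq_le_inner_laurentAct {P : ℝ[T;T⁻¹]} {c : ℝ}
    (hP : ∀ z : Circle, c ≤ (laurentEval z P).re) (x : SeqL2 E) :
    c * ‖x‖ ^ 2 ≤ inner ℝ x (laurentAct E P x) := by
  have hsub := inner_laurentAct_nonneg (P := P - C c) (fun z => by
    rw [map_sub, laurentEval_C, Complex.sub_re, Complex.ofReal_re]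
    exact sub_nonneg.2 (hP z)) x
  rwa [map_sub, _root_.sub_apply, laurentAct_C, inner_sub_right, real_inner_smul_right,
    real_inner_self_eq_norm_sq, sub_nonneg] at hsub

end Parseval

section ZamesFalb

open LaurentPolynomial

variable {E : Type*} [NormedAddCommGroup E] [InnerProductSpace ℝ E]
  {m L : ℝ} {F : E → ℝ} {G : E → E}

/-- The Zames–Falb multiplier `1 - ∑ j ∈ J, h_j z⁻ʲ` of a finitely supported impulse response. -/
noncomputable def zamesFalbPoly (J : Finset ℤ) (h : ℤ → ℝ) : ℝ[T;T⁻¹] :=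
  1 - ∑ j ∈ J, C (h j) * T j

lemma laurentAct_zamesFalbPoly (J : Finset ℤ) (h : ℤ → ℝ) (x : SeqL2 E) :
    laurentAct E (zamesFalbPoly J h) x = x - ∑ j ∈ J, h j • shift j x := by
  rw [zamesFalbPoly, map_sub, map_one, map_sum, _root_.sub_apply, _root_.sum_apply]
  simp only [laurentAct_mul_apply, laurentAct_C, laurentAct_T, one_apply_eq_self]

lemma laurentEval_zamesFalbPoly (J : Finset ℤ) (h : ℤ → ℝ) (z : Circle) :
    laurentEval z (zamesFalbPoly J h) = 1 - ∑ j ∈ J, (h j : ℂ) * (z : ℂ) ^ (-j) := by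
  simp only [zamesFalbPoly, map_sub, map_one, map_sum, map_mul, laurentEval_C, laurentEval_T]

lemma QuadraticBounds.storage_zero_le (hmL : m ≤ L) (h : QuadraticBounds m L F G) (hG : G 0 = 0)
    (a : E) : storage m L F G 0 ≤ storage m L F G a := by
  simpa [hG] using h.storage_sub_le hmL 0 a

lemma QuadraticBounds.inner_shift_le (hmL : m ≤ L) (hFG : QuadraticBounds m L F G)
    (hG : G 0 = 0) {y s : SeqL2 E} (hs : ∀ k, s k = G (y k)) (j : ℤ) :
    0 ≤ inner ℝ (s - m • y) (L • y - s) ∧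
      inner ℝ (s - m • y) (shift j (L • y - s)) ≤ inner ℝ (s - m • y) (L • y - s) := by
  set q := s - m • y
  set p := L • y - s
  let V : ℤ → ℝ := fun k => storage m L F G (y k) - storage m L F G 0
  have hq : ∀ k, q k = G (y k) - m • y k := fun k => congrArg (· - m • y k) (hs k)
  have hp : ∀ k, p k = L • y k - G (y k) := fun k => congrArg (L • y k - ·) (hs k)
  have hV₀ : ∀ k, 0 ≤ V k := fun k => sub_nonneg.2 (hFG.storage_zero_le hmL hG (y k))
  have hVle : ∀ k, V k ≤ inner ℝ (q k) (p k) := fun k => by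
    simpa [V, hG, hq, hp] using hFG.storage_sub_le hmL (y k) 0
  have hsum := lp.hasSum_inner (𝕜 := ℝ) q p
  have hV := Summable.of_nonneg_of_le hV₀ hVle hsum.summable
  have hVshift := hV.hasSum.sub ((Equiv.subRight j).hasSum_iff.2 hV.hasSum)
  have hdiff := hsum.sub (lp.hasSum_inner (𝕜 := ℝ) q (shift j p))
  have hle := hasSum_le (fun k => ?_) hVshift hdiff
  · exact ⟨hsum.nonneg fun k => (hV₀ k).trans (hVle k), by linarith⟩
  · rw [← inner_sub_right, shift_apply, hp, hp, hq]
    simpa [V] using hFG.storage_sub_le hmL (y k) (y (k - j))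

theorem QuadraticBounds.zamesFalb (hmL : m ≤ L) (hFG : QuadraticBounds m L F G) (hG : G 0 = 0)
    {J : Finset ℤ} {h : ℤ → ℝ} (h₀ : ∀ j, 0 ≤ h j) (h₁ : ∑ j ∈ J, h j ≤ 1) {y s : SeqL2 E}
    (hs : ∀ k, s k = G (y k)) :
    0 ≤ inner ℝ (s - m • y) (laurentAct E (zamesFalbPoly J h) (L • y - s)) := by
  have hpos := (hFG.inner_shift_le hmL hG hs 0).1
  rw [laurentAct_zamesFalbPoly, inner_sub_right, inner_sum, sub_nonneg]
  simp only [real_inner_smul_right]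
  calc ∑ j ∈ J, h j * inner ℝ (s - m • y) (shift j (L • y - s))
      ≤ ∑ j ∈ J, h j * inner ℝ (s - m • y) (L • y - s) := by
        gcongr with j
        · exact h₀ j
        · exact (hFG.inner_shift_le hmL hG hs j).2
    _ = (∑ j ∈ J, h j) * inner ℝ (s - m • y) (L • y - s) := (Finset.sum_mul ..).symm
    _ ≤ inner ℝ (s - m • y) (L • y - s) := mul_le_of_le_one_left hpos h₁

end ZamesFalb

section TransferFunction

open Polynomial

variable {α β η κ : ℝ} {z : ℂ}

lemma not_isRoot_denom_div {K : Type*} [Field K] {p q : K[X]} {x : K} (hx : q.eval x ≠ 0) :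
    ¬ (algebraMap K[X] (RatFunc K) p / algebraMap K[X] (RatFunc K) q).denom.IsRoot x :=
  fun hroot => hx (eval_eq_zero_of_dvd_of_eval_eq_zero
    ((RatFunc.denom_dvd fun hq => hx (by rw [hq, eval_zero])).2 ⟨p, rfl⟩) hroot)

lemma ratFunc_eval_div {K : Type*} [Field K] {p q : K[X]} {x : K} (hx : q.eval x ≠ 0) :
    (algebraMap K[X] (RatFunc K) p / algebraMap K[X] (RatFunc K) q).eval (RingHom.id K) x
      = p.eval x / q.eval x := by
  have hq : q ≠ 0 := fun hq => hx (by rw [hq, eval_zero])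
  have hcross := congrArg (eval x) ((RatFunc.num_mul_eq_mul_denom_iff hq).2 rfl :
    (algebraMap K[X] (RatFunc K) p / algebraMap K[X] (RatFunc K) q).num * q = _)
  rw [eval_mul, eval_mul] at hcross
  rw [RatFunc.eval, eval₂_id, eval₂_id, div_eq_div_iff (not_isRoot_denom_div hx) hx, hcross]

lemma IsStable.norm_lt_one_or_isRoot {p q : ℂ[X]} (hq : q ≠ 0)
    (hstable : IsStable (algebraMap ℂ[X] (RatFunc ℂ) p / algebraMap ℂ[X] (RatFunc ℂ) q))
    (hz : q.IsRoot z) : ‖z‖ < 1 ∨ p.IsRoot z := by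
  have hcross := congrArg (eval z) ((RatFunc.num_mul_eq_mul_denom_iff hq).2 rfl :
    (algebraMap ℂ[X] (RatFunc ℂ) p / algebraMap ℂ[X] (RatFunc ℂ) q).num * q = _)
  rw [eval_mul, eval_mul, hz.eq_zero, mul_zero, eq_comm, mul_eq_zero] at hcross
  exact hcross.symm.imp_left (hstable.poles z)

/-- The characteristic polynomial of the algorithm with the gradient replaced by the linear gain
`κ`. For `κ = 0` it is the denominator `(z - 1) (z - β)` of the transfer function. -/
noncomputable def closedLoopPoly (α β η κ : ℝ) : ℂ[X] :=
  (X - 1) * (X - C (β : ℂ)) + C (κ : ℂ) * (C (α : ℂ) * (C (1 + η : ℂ) * X - C (η : ℂ)))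

lemma closedLoopPoly_eval (α β η κ : ℝ) (z : ℂ) : (closedLoopPoly α β η κ).eval z
    = (z - 1) * (z - β) + κ * (α * ((1 + η) * z - η)) := by
  simp [closedLoopPoly]

lemma closedLoopPoly_monic (α β η κ : ℝ) : (closedLoopPoly α β η κ).Monic := by
  unfold closedLoopPoly
  monicity!

lemma transferFunction_eq_div (α β η : ℝ) : transferFunction α β η
    = algebraMap ℂ[X] (RatFunc ℂ) (-C (α : ℂ) * (C (1 + η : ℂ) * X - C (η : ℂ)))
      / algebraMap ℂ[X] (RatFunc ℂ) (closedLoopPoly α β η 0) := by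
  simp [transferFunction, closedLoopPoly, RatFunc.algebraMap_C, RatFunc.algebraMap_X]

lemma one_sub_mul_transferFunction (α β η κ : ℝ) :
    1 - RatFunc.C (κ : ℂ) * transferFunction α β η
      = algebraMap ℂ[X] (RatFunc ℂ) (closedLoopPoly α β η κ)
        / algebraMap ℂ[X] (RatFunc ℂ) (closedLoopPoly α β η 0) := by
  have hden := RatFunc.algebraMap_ne_zero (closedLoopPoly_monic α β η 0).ne_zero
  rw [transferFunction_eq_div, eq_div_iff hden, sub_mul, mul_assoc, div_mul_cancel₀ _ hden]
  simp only [closedLoopPoly, map_add, map_sub, map_mul, map_neg, map_one, RatFunc.algebraMap_X,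
    RatFunc.algebraMap_C, Complex.ofReal_zero, map_zero]
  ring

lemma one_sub_mul_transferFunction_eval (hz : (closedLoopPoly α β η 0).eval z ≠ 0) (κ : ℝ) :
    1 - κ * (transferFunction α β η).eval (RingHom.id ℂ) z
      = (closedLoopPoly α β η κ).eval z / (closedLoopPoly α β η 0).eval z := by
  rw [transferFunction_eq_div, ratFunc_eval_div hz, eq_div_iff hz, sub_mul, mul_assoc,
    div_mul_cancel₀ _ hz]
  simp only [closedLoopPoly_eval, eval_mul, eval_sub, eval_neg, eval_X, eval_C,
    Complex.ofReal_zero]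
  ring

lemma norm_lt_one_of_common_root (hβ : η = β * (1 + η) → |β| < 1)
    (hden : (z - 1) * (z - β) = 0) (hnum : (1 + η) * z - η = 0) : ‖z‖ < 1 := by
  rcases mul_eq_zero.1 hden with hz | hz <;> rw [sub_eq_zero.1 hz] at hnum ⊢
  · norm_num at hnum
  · rw [Complex.norm_real]
    refine hβ ?_
    have hreal : (1 + η) * β - η = 0 := by exact_mod_cast hnum
    linarith

theorem norm_lt_one_of_isRoot_closedLoopPoly (hα : α ≠ 0) (hκ : κ ≠ 0)
    (hβ : η = β * (1 + η) → |β| < 1)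
    (hstable : IsStable (1 - RatFunc.C (κ : ℂ) * transferFunction α β η)⁻¹)
    (hz : (closedLoopPoly α β η κ).IsRoot z) : ‖z‖ < 1 := by
  rw [one_sub_mul_transferFunction, inv_div] at hstable
  refine (hstable.norm_lt_one_or_isRoot (closedLoopPoly_monic α β η κ).ne_zero hz).elim id
    fun hden => ?_
  rw [IsRoot.def, closedLoopPoly_eval] at hz hden
  rw [Complex.ofReal_zero, zero_mul, add_zero] at hden
  rw [hden, zero_add] at hz
  refine norm_lt_one_of_common_root hβ hden ?_
  simpa [hκ, hα] using hz

end TransferFunction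

section FrequencyDomain

open Polynomial

variable {α β η m L : ℝ} {h : ℤ → ℝ} {z : ℂ}

lemma multiplier_form_re (m L : ℝ) (h : ℤ → ℝ) (z g : ℂ) :
    (star ![g, 1] ⬝ᵥ (multiplier m L h z *ᵥ ![g, 1])).re
      = -2 * ((1 - zTransform h z) * (star (1 - m * g) * (1 - L * g))).re := by
  have hre : ∀ w : ℂ, -2 * w.re = (-(w + star w)).re := fun w => by
    rw [Complex.neg_re, Complex.add_re, Complex.star_def, Complex.conj_re]
    ring
  rw [hre, multiplier]
  congr 1
  simp only [dotProduct, Pi.star_apply, Matrix.mulVec, Matrix.of_apply, Matrix.cons_val',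
    Matrix.cons_val_fin_one, Fin.sum_univ_two, Fin.isValue, Matrix.cons_val_zero,
    Matrix.cons_val_one, mul_one, one_mul, star_sub, star_one, star_mul', Complex.star_def,
    Complex.conj_ofReal, Complex.conj_conj, map_one]
  ring

lemma FDI.re_pos (hFDI : FDI m L h (transferFunction α β η)) (hz : ‖z‖ = 1)
    (hden : (closedLoopPoly α β η 0).eval z ≠ 0) :
    0 < ((1 - zTransform h z) * (star ((closedLoopPoly α β η m).eval z)
      * (closedLoopPoly α β η L).eval z)).re := by
  have hroot : ¬ (transferFunction α β η).denom.IsRoot z := by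
    rw [transferFunction_eq_div]
    exact not_isRoot_denom_div hden
  have hneg := hFDI z hz hroot
  rw [multiplier_form_re, one_sub_mul_transferFunction_eval hden,
    one_sub_mul_transferFunction_eval hden] at hneg
  set D := (closedLoopPoly α β η 0).eval z
  have hnormSq : (Complex.normSq D : ℂ) = star D * D := Complex.normSq_eq_conj_mul_self
  have hscale : (1 - zTransform h z) * (star ((closedLoopPoly α β η m).eval z)
        * (closedLoopPoly α β η L).eval z)
      = (Complex.normSq D : ℂ) * ((1 - zTransform h z)
        * (star ((closedLoopPoly α β η m).eval z / D)
          * ((closedLoopPoly α β η L).eval z / D))) := by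
    have hstar : star D ≠ 0 := star_ne_zero.2 hden
    rw [hnormSq, star_div₀]
    field_simp
  rw [hscale, Complex.re_ofReal_mul]
  exact mul_pos (Complex.normSq_pos.2 hden) (by linarith)

lemma star_closedLoopPoly_mul_of_pole (hden : (closedLoopPoly α β η 0).eval z = 0) :
    star ((closedLoopPoly α β η m).eval z) * (closedLoopPoly α β η L).eval z
      = (m * L * Complex.normSq (α * ((1 + η) * z - η)) : ℝ) := by
  simp only [closedLoopPoly_eval, Complex.ofReal_zero, zero_mul, add_zero] at hden ⊢
  push_cast
  rw [hden, zero_add, zero_add, Complex.normSq_eq_conj_mul_self, star_mul', Complex.star_def,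
    Complex.conj_ofReal]
  ring

lemma re_star_closedLoopPoly_mul_pos_of_pole (hα : α ≠ 0) (hmL : 0 < m * L)
    (hβ : η = β * (1 + η) → |β| < 1) (hz : ‖z‖ = 1)
    (hden : (closedLoopPoly α β η 0).eval z = 0) :
    0 < (star ((closedLoopPoly α β η m).eval z) * (closedLoopPoly α β η L).eval z).re := by
  rw [star_closedLoopPoly_mul_of_pole hden, Complex.ofReal_re]
  refine mul_pos hmL (Complex.normSq_pos.2 (mul_ne_zero (by exact_mod_cast hα) fun hnum => ?_))
  rw [closedLoopPoly_eval, Complex.ofReal_zero, zero_mul, add_zero] at hden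
  exact (norm_lt_one_of_common_root hβ hden hnum).ne hz

end FrequencyDomain

section ImpulseResponse

variable {h : ℤ → ℝ} {w : Circle → ℂ} {ε : ℝ}

lemma IsZamesFalb.sum_le_one (hh : IsZamesFalb h) (J : Finset ℤ) : ∑ j ∈ J, h j ≤ 1 :=
  (Finset.sum_le_sum fun j _ => le_abs_self (h j)).trans
    ((hh.summable.sum_le_tsum J fun j _ => abs_nonneg (h j)).trans hh.norm_le_one)

lemma IsZamesFalb.const_mul (hh : IsZamesFalb h) {c : ℝ} (hc₀ : 0 ≤ c) (hc₁ : c ≤ 1) :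
    IsZamesFalb fun k => c * h k := by
  have habs : (fun k => |c * h k|) = fun k => c * |h k| := by
    simp only [abs_mul, abs_of_nonneg hc₀]
  refine ⟨fun k => mul_nonneg hc₀ (hh.nonneg k), ?_, ?_⟩ <;> rw [habs]
  · exact hh.summable.mul_left c
  · rw [tsum_mul_left]
    exact mul_le_one₀ hc₁ (tsum_nonneg fun k => abs_nonneg (h k)) hh.norm_le_one

lemma zTransform_const_mul (c : ℝ) (h : ℤ → ℝ) (z : ℂ) :
    zTransform (fun k => c * h k) z = c * zTransform h z := by
  simp only [zTransform, Complex.ofReal_mul, mul_assoc, tsum_mul_left]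

lemma norm_mul_circle_zpow (a : ℝ) (z : Circle) (n : ℤ) : ‖(a : ℂ) * (z : ℂ) ^ n‖ = |a| := by
  rw [norm_mul, norm_zpow, Circle.norm_coe, one_zpow, mul_one, Complex.norm_real,
    Real.norm_eq_abs]

lemma IsZamesFalb.continuous_zTransform (hh : IsZamesFalb h) :
    Continuous fun z : Circle => zTransform h z :=
  continuous_tsum (fun k => continuous_const.mul (continuous_circle_zpow (-k))) hh.summable
    fun k z => (norm_mul_circle_zpow (h k) z (-k)).le

lemma IsZamesFalb.re_zTransform_le_one (hh : IsZamesFalb h) (z : Circle) :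
    (zTransform h z).re ≤ 1 := by
  refine (Complex.re_le_norm _).trans ((norm_tsum_le_tsum_norm ?_).trans ?_)
  · simpa only [norm_mul_circle_zpow] using hh.summable
  · simpa only [norm_mul_circle_zpow] using hh.norm_le_one

lemma exists_pos_add_mul_pos {X : Type*} [TopologicalSpace X] [CompactSpace X] {a b : X → ℝ}
    (ha : Continuous a) (hb : Continuous b) (ha₀ : ∀ x, 0 ≤ a x)
    (hab : ∀ x, 0 < a x ∨ 0 < b x) : ∃ ε > 0, ∀ x, 0 < a x + ε * b x := by
  have hlocal : ∀ x ∈ Set.univ, ∀ᶠ q : ℝ × X in 𝓝 (0, x), 0 < q.1 → 0 < a q.2 + q.1 * b q.2 := by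
    rintro x -
    rcases hab x with hx | hx
    · have hcont : Continuous fun q : ℝ × X => a q.2 + q.1 * b q.2 := by fun_prop
      have hpos : 0 < a x + 0 * b x := by rwa [zero_mul, add_zero]
      filter_upwards [hcont.tendsto (0, x) |>.eventually_const_lt hpos] with q hq _ using hq
    · have hcont : Continuous fun q : ℝ × X => b q.2 := by fun_prop
      filter_upwards [hcont.tendsto (0, x) |>.eventually_const_lt hx] with q hq hε
      exact add_pos_of_nonneg_of_pos (ha₀ _) (mul_pos hε hq)
  have hsmall := isCompact_univ.eventually_forall_of_forall_eventually
    (P := fun ε x => 0 < ε → 0 < a x + ε * b x) hlocal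
  obtain ⟨ε, hpos, hε⟩ := ((hsmall.filter_mono nhdsWithin_le_nhds).and
    (self_mem_nhdsWithin : Set.Ioi (0 : ℝ) ∈ 𝓝[>] 0)).exists
  exact ⟨ε, hε, fun x => hpos x (Set.mem_univ x) hε⟩

lemma IsZamesFalb.exists_forall_re_pos (hh : IsZamesFalb h) (hw : Continuous w)
    (hnonneg : ∀ z : Circle, 0 ≤ ((1 - zTransform h z) * w z).re)
    (hpos : ∀ z : Circle, 0 < ((1 - zTransform h z) * w z).re ∨ 0 < (w z).re) :
    ∃ h', IsZamesFalb h' ∧ ∀ z : Circle, 0 < ((1 - zTransform h' z) * w z).re := by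
  obtain ⟨ε, hε, hlt⟩ := exists_pos_add_mul_pos
    (Complex.continuous_re.comp ((continuous_const.sub hh.continuous_zTransform).mul hw))
    (Complex.continuous_re.comp hw) hnonneg hpos
  have hc : 0 < (1 + ε)⁻¹ := by positivity
  refine ⟨_, hh.const_mul hc.le (inv_le_one_of_one_le₀ (by linarith)), fun z => ?_⟩
  have hsplit : (1 - zTransform (fun k => (1 + ε)⁻¹ * h k) z) * w z
      = ((1 + ε)⁻¹ : ℝ) * ((1 - zTransform h z) * w z + (ε : ℝ) * w z) := by
    have hne : (1 + ε : ℂ) ≠ 0 := by exact_mod_cast (by positivity : 1 + ε ≠ 0)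
    rw [zTransform_const_mul]
    push_cast
    field_simp
    ring
  rw [hsplit, Complex.re_ofReal_mul, Complex.add_re, Complex.re_ofReal_mul]
  exact mul_pos hc (hlt z)

lemma IsZamesFalb.exists_finset_forall_le_re (hh : IsZamesFalb h) (hw : Continuous w)
    (hpos : ∀ z : Circle, 0 < ((1 - zTransform h z) * w z).re) :
    ∃ (J : Finset ℤ) (c : ℝ), 0 < c ∧
      ∀ z : Circle, c ≤ ((1 - ∑ j ∈ J, (h j : ℂ) * (z : ℂ) ^ (-j)) * w z).re := by
  obtain ⟨c, hc, hle⟩ := isCompact_univ.exists_forall_le'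
    (Complex.continuous_re.comp
      ((continuous_const.sub hh.continuous_zTransform).mul hw)).continuousOn fun z _ => hpos z
  obtain ⟨B, hB⟩ := isCompact_univ.exists_bound_of_continuousOn hw.continuousOn
  have hunif := tendstoUniformly_tsum (f := fun (j : ℤ) (z : Circle) => h j * (z : ℂ) ^ (-j) * w z)
    (hh.summable.mul_right B) fun j z => by
      rw [norm_mul, norm_mul_circle_zpow]
      exact mul_le_mul_of_nonneg_left (hB z (Set.mem_univ z)) (abs_nonneg _)
  obtain ⟨J, hJ⟩ := (Metric.tendstoUniformly_iff.1 hunif (c / 2) (by positivity)).exists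
  refine ⟨J, c / 2, by positivity, fun z => ?_⟩
  have hz := (Complex.re_le_norm _).trans_lt (dist_eq_norm (_ : ℂ) _ ▸ dist_comm (_ : ℂ) _ ▸ hJ z)
  rw [tsum_mul_right, ← Finset.sum_mul, Complex.sub_re] at hz
  have hcz : c ≤ ((1 - zTransform h z) * w z).re := hle z (Set.mem_univ z)
  rw [sub_mul, one_mul, Complex.sub_re] at hcz ⊢
  rw [zTransform] at hcz
  linarith

end ImpulseResponse

section UniformFrequencyDomain

open LaurentPolynomial

variable {α β η m L : ℝ} {h : ℤ → ℝ}

/-- The Laurent polynomial with which the algorithm in open loop plus the linear gain `κ` acts on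
state sequences. -/
noncomputable def loopPoly (α β η κ : ℝ) : ℝ[T;T⁻¹] :=
  T (-1) - C (1 + β) + C β * T 1 + C (κ * α) * (C (1 + η) - C η * T 1)

lemma laurentEval_loopPoly (α β η κ : ℝ) (z : Circle) :
    laurentEval z (loopPoly α β η κ) = (z : ℂ)⁻¹ * (closedLoopPoly α β η κ).eval (z : ℂ) := by
  have hz := Circle.coe_ne_zero z
  simp only [loopPoly, closedLoopPoly_eval, map_add, map_sub, map_mul, laurentEval_T,
    laurentEval_C, Complex.ofReal_one, neg_neg, zpow_one, zpow_neg]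
  field_simp
  ring

lemma star_laurentEval_loopPoly_mul (α β η m L : ℝ) (z : Circle) :
    star (laurentEval z (loopPoly α β η m)) * laurentEval z (loopPoly α β η L)
      = star ((closedLoopPoly α β η m).eval (z : ℂ)) * (closedLoopPoly α β η L).eval (z : ℂ) := by
  have hz : star ((z : ℂ)⁻¹) * (z : ℂ)⁻¹ = 1 := by
    rw [Complex.star_def, Complex.conj_mul', norm_inv, Circle.norm_coe]
    norm_num
  rw [laurentEval_loopPoly, laurentEval_loopPoly, star_mul']
  linear_combination (star ((closedLoopPoly α β η m).eval (z : ℂ))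
    * (closedLoopPoly α β η L).eval (z : ℂ)) * hz

theorem FDI.exists_uniform (hα : α ≠ 0) (hmL : 0 < m * L) (hβ : η = β * (1 + η) → |β| < 1)
    (hh : IsZamesFalb h) (hFDI : FDI m L h (transferFunction α β η)) :
    ∃ (J : Finset ℤ) (h' : ℤ → ℝ) (c : ℝ), (∀ j, 0 ≤ h' j) ∧ ∑ j ∈ J, h' j ≤ 1 ∧ 0 < c ∧
      ∀ z, c ≤ (laurentEval z
        (invert (loopPoly α β η m) * (zamesFalbPoly J h' * loopPoly α β η L))).re := by
  set w : Circle → ℂ := fun z => laurentEval z (invert (loopPoly α β η m) * loopPoly α β η L)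
  have hw : ∀ z : Circle, w z = star ((closedLoopPoly α β η m).eval (z : ℂ))
      * (closedLoopPoly α β η L).eval (z : ℂ) := fun z => by
    rw [← star_laurentEval_loopPoly_mul, ← laurentEval_invert, ← map_mul]
  have hregular : ∀ z : Circle, (closedLoopPoly α β η 0).eval (z : ℂ) ≠ 0 →
      0 < ((1 - zTransform h z) * w z).re := fun z hz => hw z ▸ hFDI.re_pos (Circle.norm_coe z) hz
  have hpole : ∀ z : Circle, (closedLoopPoly α β η 0).eval (z : ℂ) = 0 → 0 < (w z).re :=
    fun z hz => hw z ▸ re_star_closedLoopPoly_mul_pos_of_pole hα hmL hβ (Circle.norm_coe z) hz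
  have hnonneg : ∀ z : Circle, 0 ≤ ((1 - zTransform h z) * w z).re := fun z => by
    by_cases hz : (closedLoopPoly α β η 0).eval (z : ℂ) = 0
    · rw [hw, star_closedLoopPoly_mul_of_pole hz, Complex.re_mul_ofReal, Complex.sub_re,
        Complex.one_re]
      exact mul_nonneg (sub_nonneg.2 (hh.re_zTransform_le_one z))
        (mul_nonneg hmL.le (Complex.normSq_nonneg _))
    · exact (hregular z hz).le
  obtain ⟨h', hh', hstrict⟩ := hh.exists_forall_re_pos (continuous_laurentEval _) hnonneg
    fun z => (em _).symm.imp (hregular z) (hpole z)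
  obtain ⟨J, c, hc, hle⟩ := hh'.exists_finset_forall_le_re (continuous_laurentEval _) hstrict
  refine ⟨J, h', c, hh'.nonneg, hh'.sum_le_one J, hc, fun z => ?_⟩
  rw [mul_left_comm, map_mul, laurentEval_zamesFalbPoly]
  exact hle z

end UniformFrequencyDomain

section Dynamics

variable {E : Type*} [NormedAddCommGroup E] [InnerProductSpace ℝ E]
  {α β η K δ : ℝ} {G G' : E → E} {x x' : ℤ → E} {k : ℤ}

/-- One step of the algorithm for a gradient field `G` that need not be the gradient of a given
function. -/
def gradientStep (α β η : ℝ) (G : E → E) (p : E × E) : E × E :=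
  (p.1 + β • (p.1 - p.2) - α • G (p.1 + η • (p.1 - p.2)), p.1)

/-- The points `y_k = x_k + η (x_k - x_{k-1})` at which the gradient is evaluated. -/
def output (η : ℝ) (x : ℤ → E) (k : ℤ) : E := x k + η • (x k - x (k - 1))

/-- The defect of the sequence `x` as a solution of the algorithm with gradient field `G`, that is
the input that has to be added to the recursion for `x` to solve it. -/
def residual (α β η : ℝ) (G : E → E) (x : ℤ → E) (k : ℤ) : E :=
  x (k + 1) - x k - β • (x k - x (k - 1)) + α • G (output η x k)

/-- Square-summable inputs drive the algorithm, started at rest, along square-summable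
trajectories. -/
def L2Stable (α β η : ℝ) (G : E → E) : Prop :=
  ∀ x : ℤ → E, (∀ k ≤ 0, x k = 0) → Memℓp (residual α β η G x) 2 → Memℓp x 2

/-- A square-summable solution is bounded by `K` times the input that drives it. -/
def GainBound (α β η K : ℝ) (G : E → E) : Prop :=
  ∀ x r : SeqL2 E, (∀ k, residual α β η G x k = r k) → ‖x‖ ≤ K * ‖r‖

lemma residual_sub_residual (α β η : ℝ) (G G' : E → E) (x : ℤ → E) (k : ℤ) :
    residual α β η G' x k - residual α β η G x k
      = α • (G' (output η x k) - G (output η x k)) := by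
  rw [residual, residual, add_sub_add_left_eq_sub, smul_sub]

lemma output_congr (h₀ : x k = x' k) (h₁ : x (k - 1) = x' (k - 1)) :
    output η x k = output η x' k := by
  rw [output, output, h₀, h₁]

lemma residual_congr (h₀ : x k = x' k) (h₁ : x (k - 1) = x' (k - 1))
    (h₂ : x (k + 1) = x' (k + 1)) : residual α β η G x k = residual α β η G x' k := by
  rw [residual, residual, output_congr h₀ h₁, h₀, h₁, h₂]

lemma exists_extension (α β η : ℝ) (G : E → E) (r x : ℤ → E) (N : ℤ) :
    ∃ X : ℤ → E, (∀ k ≤ N, X k = x k) ∧ ∀ k ≥ N, residual α β η G X k = r k := by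
  let state : ℕ → E × E := Nat.rec (x N, x (N - 1)) fun n p =>
    gradientStep α β η G p + (r (N + n), 0)
  let X : ℤ → E := fun k => if k ≤ N then x k else (state (k - N).toNat).1
  have hfst : ∀ n : ℕ, X (N + n) = (state n).1 := fun n => by
    cases n with
    | zero => simp [X, state]
    | succ n => simp [X, show ¬ N + ((n : ℤ) + 1) ≤ N by omega]
  have hsnd : ∀ n : ℕ, X (N + n - 1) = (state n).2 := fun n => by
    cases n with
    | zero => simp [X, state]
    | succ n =>
      rw [show N + ((n + 1 : ℕ) : ℤ) - 1 = N + n by push_cast; ring, hfst]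
      simp [state, gradientStep]
  refine ⟨X, fun k hk => if_pos hk, fun k hk => ?_⟩
  obtain ⟨n, rfl⟩ := Int.le.dest hk
  have hnext : X (N + n + 1) = (state n).1 + β • ((state n).1 - (state n).2)
      - α • G ((state n).1 + η • ((state n).1 - (state n).2)) + r (N + n) := by
    rw [show N + (n : ℤ) + 1 = N + ((n + 1 : ℕ) : ℤ) by push_cast; ring, hfst]
    rfl
  rw [residual, output, hnext, hfst, hsnd]
  abel

/-- The output sequence of a square-summable state sequence, see `outputSeq_apply`. -/
noncomputable def outputSeq (η : ℝ) (x : SeqL2 E) : SeqL2 E := (1 + η) • x - η • shift 1 x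

lemma outputSeq_apply (η : ℝ) (x : SeqL2 E) (k : ℤ) : outputSeq η x k = output η x k := by
  have happly : outputSeq η x k = (1 + η) • x k - η • x (k - 1) := rfl
  rw [happly, output]
  module

lemma norm_outputSeq_le (η : ℝ) (x : SeqL2 E) : ‖outputSeq η x‖ ≤ (1 + 2 * |η|) * ‖x‖ := by
  calc ‖outputSeq η x‖ ≤ |1 + η| * ‖x‖ + |η| * ‖x‖ := by
        refine (norm_sub_le _ _).trans_eq ?_
        rw [norm_smul, norm_smul, LinearIsometry.norm_map, Real.norm_eq_abs, Real.norm_eq_abs]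
    _ ≤ (1 + |η|) * ‖x‖ + |η| * ‖x‖ := by
        gcongr
        exact (abs_add_le 1 η).trans_eq (by rw [abs_one])
    _ = (1 + 2 * |η|) * ‖x‖ := by ring

lemma L2Stable.exists_truncation (hδ : 0 ≤ δ) (hstab : L2Stable α β η G)
    (hclose : ∀ a, ‖G' a - G a‖ ≤ δ * ‖a‖) (hx : ∀ k ≤ 0, x k = 0)
    (r : SeqL2 E) (hr : ∀ k, residual α β η G' x k = r k) (N : ℕ) :
    ∃ X e : SeqL2 E, (∀ k ≤ (N : ℤ), X k = x k) ∧ (∀ k, residual α β η G X k = (r - e) k) ∧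
      ∀ k, ‖e k‖ ≤ |α| * (δ * ‖outputSeq η X k‖) := by
  obtain ⟨X, hXx, hX⟩ := exists_extension α β η G r x N
  let e : ℤ → E := fun k => r k - residual α β η G X k
  have hlate : ∀ k ≥ (N : ℤ), e k = 0 := fun k hk => sub_eq_zero.2 (hX k hk).symm
  have hbound : ∀ k < (N : ℤ), ‖e k‖ ≤ |α| * (δ * ‖output η X k‖) := fun k hk => by
    have hres : residual α β η G X k = residual α β η G x k :=
      residual_congr (hXx k hk.le) (hXx _ (by omega)) (hXx _ hk)
    have hout : output η X k = output η x k := output_congr (hXx k hk.le) (hXx _ (by omega))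
    change ‖r k - residual α β η G X k‖ ≤ _
    rw [hres, ← hr, residual_sub_residual, norm_smul, Real.norm_eq_abs, hout]
    gcongr
    exact hclose _
  have hearly : ∀ k < 0, e k = 0 := fun k hk => by
    have hout : output η X k = 0 := by
      rw [output, hXx k (by omega), hXx (k - 1) (by omega), hx k hk.le, hx (k - 1) (by omega),
        sub_self, smul_zero, add_zero]
    simpa [hout] using hbound k (by omega)
  have he : Memℓp e 2 := by
    refine (memℓp_zero ((Set.finite_Ico 0 (N : ℤ)).subset fun k hk => ?_)).of_exponent_ge zero_le
    exact ⟨not_lt.1 fun h => hk (hearly k h), not_le.1 fun h => hk (hlate k h)⟩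
  have hXr : residual α β η G X = r - e := funext fun k => (sub_sub_cancel _ _).symm
  have hXmem : Memℓp X 2 := hstab X (fun k hk => (hXx k (by omega)).trans (hx k hk))
    (hXr ▸ (lp.memℓp r).sub he)
  refine ⟨⟨X, hXmem⟩, ⟨e, he⟩, hXx, congrFun hXr, fun k => ?_⟩
  rw [outputSeq_apply]
  rcases lt_or_ge k N with hk | hk
  · exact hbound k hk
  · change ‖e k‖ ≤ _
    rw [hlate k hk, norm_zero]
    positivity

/-- The a priori bound survives truncation, so the perturbed trajectory is bounded in `ℓ²`
uniformly in the truncation time. -/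
theorem L2Stable.perturb (hK : 0 ≤ K) (hδ : 0 ≤ δ) (hstab : L2Stable α β η G)
    (hgain : GainBound α β η K G) (hclose : ∀ a, ‖G' a - G a‖ ≤ δ * ‖a‖)
    (hsmall : K * (|α| * (δ * (1 + 2 * |η|))) ≤ 1 / 2) : L2Stable α β η G' := by
  intro x hx hr
  let r : SeqL2 E := ⟨_, hr⟩
  refine memℓp_two_of_forall_le (C := 2 * (K * ‖r‖)) fun N => ?_
  obtain ⟨X, e, hXx, hX, he⟩ := hstab.exists_truncation hδ hclose hx r (fun k => rfl) N
  have hnorm : ‖e‖ ≤ ‖(|α| * δ) • outputSeq η X‖ :=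
    lp.norm_mono two_ne_zero fun k => (he k).trans_eq <| by
      rw [lp.coeFn_smul, Pi.smul_apply, norm_smul, Real.norm_of_nonneg (by positivity), mul_assoc]
  rw [norm_smul, Real.norm_of_nonneg (by positivity)] at hnorm
  have hself : ‖X‖ ≤ K * ‖r‖ + 1 / 2 * ‖X‖ :=
    calc ‖X‖ ≤ K * ‖r - e‖ := hgain X (r - e) hX
      _ ≤ K * (‖r‖ + |α| * δ * ((1 + 2 * |η|) * ‖X‖)) := by
        gcongr
        refine (norm_sub_le _ _).trans ?_
        gcongr
        refine hnorm.trans ?_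
        gcongr
        exact norm_outputSeq_le η X
      _ = K * ‖r‖ + K * (|α| * (δ * (1 + 2 * |η|))) * ‖X‖ := by ring
      _ ≤ K * ‖r‖ + 1 / 2 * ‖X‖ := by gcongr
  exact ⟨X, by linarith, hXx⟩

end Dynamics

section LinearGain

lemma summable_of_succ_le_mul_add {u v : ℕ → ℝ} {t : ℝ} (ht : t < 1) (hu : ∀ n, 0 ≤ u n)
    (hv : Summable v) (hv₀ : ∀ n, 0 ≤ v n) (h : ∀ n, u (n + 1) ≤ t * u n + v n) : Summable u := by
  refine summable_of_sum_range_le (c := (u 0 + ∑' n, v n) / (1 - t)) hu fun n => ?_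
  have hsum : ∑ k ∈ Finset.range n, u (k + 1) ≤ t * ∑ k ∈ Finset.range n, u k + ∑' n, v n :=
    calc ∑ k ∈ Finset.range n, u (k + 1) ≤ ∑ k ∈ Finset.range n, (t * u k + v k) :=
          Finset.sum_le_sum fun k _ => h k
      _ = t * ∑ k ∈ Finset.range n, u k + ∑ k ∈ Finset.range n, v k := by
          rw [Finset.sum_add_distrib, Finset.mul_sum]
      _ ≤ t * ∑ k ∈ Finset.range n, u k + ∑' n, v n := by
          gcongr
          exact hv.sum_le_tsum _ fun k _ => hv₀ k
  have htelescope := (Finset.sum_range_succ u n).symm.trans (Finset.sum_range_succ' u n)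
  rw [le_div_iff₀ (sub_pos.2 ht)]
  linarith [hu n]

section Recursion

variable {F : Type*} [NormedAddCommGroup F] [NormedSpace ℂ F] {x r : ℤ → F} {μ ν : ℂ}

lemma sq_add_le_mul_sq_add_div {t : ℝ} (ht₀ : 0 ≤ t) (ht₁ : t < 1) (u v : ℝ) :
    (t * u + v) ^ 2 ≤ t * u ^ 2 + v ^ 2 / (1 - t) := by
  have ht : 0 < 1 - t := sub_pos.2 ht₁
  have hgap : t * u ^ 2 + v ^ 2 / (1 - t) - (t * u + v) ^ 2
      = t * ((1 - t) * u - v) ^ 2 / (1 - t) := by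
    field_simp
    ring
  have hnonneg : 0 ≤ t * ((1 - t) * u - v) ^ 2 / (1 - t) := by positivity
  linarith

lemma memℓp_two_of_first_order (hμ : ‖μ‖ < 1) (hx : ∀ k ≤ 0, x k = 0) (hr : Memℓp r 2)
    (h : ∀ k, x (k + 1) = μ • x k + r k) : Memℓp x 2 := by
  have hstep : ∀ k, ‖x (k + 1)‖ ^ 2 ≤ ‖μ‖ * ‖x k‖ ^ 2 + ‖r k‖ ^ 2 / (1 - ‖μ‖) := fun k =>
    calc ‖x (k + 1)‖ ^ 2 ≤ (‖μ‖ * ‖x k‖ + ‖r k‖) ^ 2 := by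
          rw [h, ← norm_smul]
          gcongr
          exact norm_add_le _ _
      _ ≤ ‖μ‖ * ‖x k‖ ^ 2 + ‖r k‖ ^ 2 / (1 - ‖μ‖) :=
          sq_add_le_mul_sq_add_div (norm_nonneg μ) hμ _ _
  have hsupport : ∀ k ∉ Set.range ((↑) : ℕ → ℤ), ‖x k‖ ^ 2 = 0 := fun k hk => by
    have hneg : k < 0 := not_le.1 fun hk₀ => hk ⟨k.toNat, Int.toNat_of_nonneg hk₀⟩
    rw [hx k hneg.le, norm_zero, sq, zero_mul]
  rw [memℓp_two_iff, ← Nat.cast_injective.summable_iff hsupport]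
  refine summable_of_succ_le_mul_add hμ (fun n => sq_nonneg _)
    (((memℓp_two_iff.1 hr).comp_injective Nat.cast_injective).div_const (1 - ‖μ‖))
    (fun n => div_nonneg (sq_nonneg _) (sub_pos.2 hμ).le) fun n => ?_
  simpa only [Function.comp_apply, Nat.cast_succ] using hstep n

lemma memℓp_two_of_second_order (hμ : ‖μ‖ < 1) (hν : ‖ν‖ < 1) (hx : ∀ k ≤ 0, x k = 0)
    (hr : Memℓp r 2) (h : ∀ k, x (k + 1) = (μ + ν) • x k - (μ * ν) • x (k - 1) + r k) :
    Memℓp x 2 := by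
  let w : ℤ → F := fun k => x k - ν • x (k - 1)
  have hw : Memℓp w 2 := by
    refine memℓp_two_of_first_order hμ (fun k hk => ?_) hr fun k => ?_
    · simp only [w, hx k hk, hx (k - 1) (by omega), smul_zero, sub_zero]
    · simp only [w, h, add_sub_cancel_right]
      module
  have hw_succ : Memℓp (fun k => w (k + 1)) 2 := by
    simpa only [sub_neg_eq_add] using memℓp_two_comp_sub (-1) hw
  refine memℓp_two_of_first_order hν hx hw_succ fun k => ?_
  simp only [w, add_sub_cancel_right, add_sub_cancel]

end Recursion

variable {α β η κ : ℝ}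

lemma exists_roots_closedLoopPoly (α β η κ : ℝ) :
    ∃ μ ν : ℂ, (closedLoopPoly α β η κ).IsRoot μ ∧ (closedLoopPoly α β η κ).IsRoot ν ∧
      μ + ν = (1 + β - κ * α * (1 + η) : ℝ) ∧ μ * ν = (β - κ * α * η : ℝ) := by
  have hdegree : (closedLoopPoly α β η κ).natDegree = 2 := by
    unfold closedLoopPoly
    compute_degree!
  obtain ⟨μ, hμ⟩ := IsAlgClosed.exists_root (closedLoopPoly α β η κ)
    (Polynomial.natDegree_pos_iff_degree_pos.1 (by omega)).ne'
  refine ⟨μ, (1 + β - κ * α * (1 + η) : ℝ) - μ, hμ, ?_, add_sub_cancel _ _, ?_⟩ <;>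
    rw [Polynomial.IsRoot, closedLoopPoly_eval] at *
  · push_cast
    linear_combination hμ
  · push_cast
    linear_combination -hμ

variable {E : Type*} [NormedAddCommGroup E] [InnerProductSpace ℝ E]

lemma memℓp_two_of_norm_eq {ι F F' : Type*} [NormedAddCommGroup F] [NormedAddCommGroup F']
    {x : ι → F} {y : ι → F'} (h : ∀ k, ‖y k‖ = ‖x k‖) (hx : Memℓp x 2) : Memℓp y 2 := by
  rw [memℓp_two_iff] at hx ⊢
  simpa only [h] using hx

/-- The isometric embedding of a real inner product space into a complex normed space that sends
`a` to the functional `⟪a, ·⟫`. -/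
noncomputable def complexDual : E →ₗᵢ[ℝ] E →L[ℝ] ℂ where
  toFun a := Complex.ofRealLI.toContinuousLinearMap.comp (innerSL ℝ a)
  map_add' a b := by rw [map_add, ContinuousLinearMap.comp_add]
  map_smul' c a := by rw [map_smul, ContinuousLinearMap.comp_smul, RingHom.id_apply]
  norm_map' a := (LinearIsometry.norm_toContinuousLinearMap_comp _).trans (innerSL_apply_norm _ a)

theorem L2Stable.of_linear
    (hroots : ∀ z : ℂ, (closedLoopPoly α β η κ).IsRoot z → ‖z‖ < 1) :
    L2Stable α β η fun a : E => κ • a := by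
  intro x hx hr
  obtain ⟨μ, ν, hμ, hν, hadd, hmul⟩ := exists_roots_closedLoopPoly α β η κ
  have hrecursion : ∀ k, x (k + 1) = (1 + β - κ * α * (1 + η)) • x k
      - (β - κ * α * η) • x (k - 1) + residual α β η (fun a : E => κ • a) x k := fun k => by
    rw [residual, output]
    module
  refine memℓp_two_of_norm_eq (fun k => ((complexDual (E := E)).norm_map (x k)).symm) <|
    memℓp_two_of_second_order (hroots μ hμ) (hroots ν hν) (fun k hk => by rw [hx k hk, map_zero])
      (memℓp_two_of_norm_eq (fun k => complexDual.norm_map _) hr) fun k => ?_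
  rw [hrecursion, map_add, map_sub, map_smul, map_smul, hadd, hmul, Complex.coe_smul,
    Complex.coe_smul]

end LinearGain

section Gain

lemma le_mul_of_sq_le_add {b c d u v : ℝ} (hb : 0 ≤ b) (hc : 0 < c) (hd : 0 ≤ d) (hv : 0 ≤ v)
    (h : c * u ^ 2 ≤ b * (u * v) + d * v ^ 2) : u ≤ ((b + d) / c + 1) * v := by
  have hq : 0 ≤ (b + d) / c * v := by positivity
  rcases le_or_gt u v with huv | huv
  · linarith
  · have hu : 0 < u := hv.trans_lt huv
    have hcu : u * c ≤ (b + d) * v := by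
      refine le_of_mul_le_mul_right ?_ hu
      nlinarith [mul_le_mul_of_nonneg_left huv.le (mul_nonneg hd hv)]
    have huq : u ≤ (b + d) / c * v := by rwa [div_mul_eq_mul_div, le_div_iff₀ hc]
    linarith

lemma norm_le_of_le_inner_of_inner_nonneg {H : Type*} [NormedAddCommGroup H]
    [InnerProductSpace ℝ H] (A B M : H →L[ℝ] H) {c : ℝ} (hc : 0 < c) {x r : H}
    (hx : c * ‖x‖ ^ 2 ≤ inner ℝ (A x) (M (B x))) (hr : 0 ≤ inner ℝ (r - A x) (M (B x - r))) :
    ‖x‖ ≤ ((‖A‖ * ‖M‖ + ‖M‖ * ‖B‖ + ‖M‖) / c + 1) * ‖r‖ := by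
  have hexpand : inner ℝ (r - A x) (M (B x - r)) = inner ℝ r (M (B x)) + inner ℝ (A x) (M r)
      - inner ℝ (A x) (M (B x)) - inner ℝ r (M r) := by
    rw [map_sub, inner_sub_left, inner_sub_right, inner_sub_right]
    ring
  have hinner (u v : H) : |inner ℝ u (M v)| ≤ ‖u‖ * (‖M‖ * ‖v‖) :=
    (abs_real_inner_le_norm _ _).trans
      (mul_le_mul_of_nonneg_left (M.le_opNorm v) (norm_nonneg u))
  refine le_mul_of_sq_le_add (by positivity) hc (norm_nonneg M) (norm_nonneg r) ?_
  calc c * ‖x‖ ^ 2 ≤ inner ℝ r (M (B x)) + inner ℝ (A x) (M r) - inner ℝ r (M r) := by linarith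
    _ ≤ ‖r‖ * (‖M‖ * ‖B x‖) + ‖A x‖ * (‖M‖ * ‖r‖) + ‖r‖ * (‖M‖ * ‖r‖) := by
        linarith [(abs_le.1 (hinner r (B x))).2, (abs_le.1 (hinner (A x) r)).2,
          (abs_le.1 (hinner r r)).1]
    _ ≤ ‖r‖ * (‖M‖ * (‖B‖ * ‖x‖)) + ‖A‖ * ‖x‖ * (‖M‖ * ‖r‖) + ‖r‖ * (‖M‖ * ‖r‖) := by
        gcongr
        · exact B.le_opNorm x
        · exact A.le_opNorm x
    _ = (‖A‖ * ‖M‖ + ‖M‖ * ‖B‖) * (‖x‖ * ‖r‖) + ‖M‖ * ‖r‖ ^ 2 := by ring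

open LaurentPolynomial

variable {E : Type*} [NormedAddCommGroup E] [InnerProductSpace ℝ E] {α β η m L c : ℝ}

lemma laurentAct_loopPoly_apply (α β η κ : ℝ) (x : SeqL2 E) (k : ℤ) :
    laurentAct E (loopPoly α β η κ) x k = residual α β η (fun a => κ • a) x k := by
  have happly : laurentAct E (loopPoly α β η κ) x k = x (k - -1) - (1 + β) • x k + β • x (k - 1)
      + (κ * α) • ((1 + η) • x k - η • x (k - 1)) := by
    simp only [loopPoly, map_add (laurentAct E), map_sub (laurentAct E), laurentAct_mul_apply,
      _root_.add_apply, _root_.sub_apply, laurentAct_C, laurentAct_T]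
    rfl
  rw [happly, residual, output, sub_neg_eq_add]
  module

lemma exists_feedback (hα : α ≠ 0) {G : E → E} {x r : SeqL2 E}
    (hx : ∀ k, residual α β η G x k = r k) :
    ∃ s : SeqL2 E, (∀ k, s k = G (outputSeq η x k)) ∧
      ∀ κ : ℝ, r - laurentAct E (loopPoly α β η κ) x = α • (s - κ • outputSeq η x) := by
  have hresidual (κ : ℝ) (k : ℤ) : (r - laurentAct E (loopPoly α β η κ) x) k
      = α • (G (outputSeq η x k) - κ • outputSeq η x k) := by
    rw [outputSeq_apply, ← residual_sub_residual, hx, ← laurentAct_loopPoly_apply]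
    rfl
  let s : SeqL2 E := α⁻¹ • (r - laurentAct E (loopPoly α β η 0) x)
  have hs (k : ℤ) : s k = G (outputSeq η x k) := by
    have hsmul : s k = α⁻¹ • (r - laurentAct E (loopPoly α β η 0) x) k := rfl
    rw [hsmul, hresidual, inv_smul_smul₀ hα, zero_smul, sub_zero]
  refine ⟨s, hs, fun κ => lp.ext (funext fun k => ?_)⟩
  rw [hresidual, ← hs]
  rfl

theorem exists_gainBound (hα : α ≠ 0) (hmL : m ≤ L) {J : Finset ℤ} {h : ℤ → ℝ}
    (h₀ : ∀ j, 0 ≤ h j) (h₁ : ∑ j ∈ J, h j ≤ 1) (hc : 0 < c)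
    (hfreq : ∀ z, c ≤ (laurentEval z
      (invert (loopPoly α β η m) * (zamesFalbPoly J h * loopPoly α β η L))).re) :
    ∃ K, 0 ≤ K ∧ ∀ (F : E → ℝ) (G : E → E), QuadraticBounds m L F G → G 0 = 0 →
      GainBound α β η K G := by
  let A := laurentAct E (loopPoly α β η m)
  let B := laurentAct E (loopPoly α β η L)
  let M := laurentAct E (zamesFalbPoly J h)
  refine ⟨(‖A‖ * ‖M‖ + ‖M‖ * ‖B‖ + ‖M‖) / c + 1, by positivity, fun F G hFG hG x r hx => ?_⟩
  obtain ⟨s, hs, hfeedback⟩ := exists_feedback hα hx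
  refine norm_le_of_le_inner_of_inner_nonneg A B M hc ?_ ?_
  · refine (mul_norm_sq_le_inner_laurentAct hfreq x).trans_eq ?_
    rw [laurentAct_mul_apply, laurentAct_mul_apply, ← inner_laurentAct_left]
  · have hB : B x - r = α • (L • outputSeq η x - s) := by
      rw [← neg_sub, hfeedback, ← smul_neg, neg_sub]
    rw [hfeedback, hB, map_smul, real_inner_smul_left, real_inner_smul_right, ← mul_assoc]
    exact mul_nonneg (mul_self_nonneg α) (hFG.zamesFalb hmL hG h₀ h₁ hs)

end Gain

section Homotopy

variable {E : Type*} [NormedAddCommGroup E] [InnerProductSpace ℝ E] {α β η K B : ℝ}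

theorem L2Stable.homotopy {G₀ G₁ : E → E} (hK : 0 ≤ K) (hB : 0 ≤ B) (h₀ : L2Stable α β η G₀)
    (hgain : ∀ t ∈ Set.Icc (0 : ℝ) 1, GainBound α β η K fun a => (1 - t) • G₀ a + t • G₁ a)
    (hclose : ∀ a, ‖G₁ a - G₀ a‖ ≤ B * ‖a‖) : L2Stable α β η G₁ := by
  obtain ⟨n, hn⟩ := exists_nat_gt (2 * (K * (|α| * (B * (1 + 2 * |η|)))))
  have hn₀ : (0 : ℝ) < n := lt_of_le_of_lt (by positivity) hn
  let G : ℝ → E → E := fun t a => (1 - t) • G₀ a + t • G₁ a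
  have hstep (t : ℝ) (a : E) : ‖G (t + 1 / n) a - G t a‖ ≤ B / n * ‖a‖ :=
    calc ‖G (t + 1 / n) a - G t a‖ = ‖(1 / n : ℝ) • (G₁ a - G₀ a)‖ := by
          congr 1
          module
      _ ≤ 1 / n * (B * ‖a‖) := by
          rw [norm_smul, Real.norm_of_nonneg (by positivity)]
          gcongr
          exact hclose a
      _ = B / n * ‖a‖ := by ring
  have hsmall : K * (|α| * (B / n * (1 + 2 * |η|))) ≤ 1 / 2 :=
    calc K * (|α| * (B / n * (1 + 2 * |η|))) = K * (|α| * (B * (1 + 2 * |η|))) / n := by ring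
      _ ≤ 1 / 2 := by
          rw [div_le_iff₀ hn₀]
          linarith
  have hind : ∀ j ≤ n, L2Stable α β η (G (j / n)) := fun j => by
    induction j with
    | zero => simpa [G] using h₀
    | succ j ih =>
      intro hj
      have ht : (j : ℝ) / n ∈ Set.Icc (0 : ℝ) 1 :=
        ⟨by positivity, div_le_one_of_le₀ (by exact_mod_cast (Nat.le_of_succ_le hj)) hn₀.le⟩
      rw [Nat.cast_succ, add_div]
      exact (ih (Nat.le_of_succ_le hj)).perturb hK (by positivity) (hgain _ ht) (hstep _) hsmall
  simpa [G, div_self hn₀.ne'] using hind n le_rfl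

end Homotopy

section Stability

lemma GloballyAsymptoticallyStable.of_translate {V : Type*} [SeminormedAddCommGroup V]
    {S T : V → V} {c : V} (hS : GloballyAsymptoticallyStable S 0)
    (hST : ∀ q, T (c + q) = c + S q) : GloballyAsymptoticallyStable T c := by
  have hiterate (n : ℕ) (q : V) : T^[n] q = c + S^[n] (q - c) := by
    have hsemiconj : Function.Semiconj (c + ·) S T := fun q => (hST q).symm
    simpa only [add_sub_cancel] using ((hsemiconj.iterate_right n) (q - c)).symm
  refine ⟨?_, fun ε hε => ?_, fun q => ?_⟩
  · simpa only [add_zero, hS.equilibrium] using hST 0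
  · obtain ⟨δ, hδ, hstable⟩ := hS.stable ε hε
    refine ⟨δ, hδ, fun q hq n => ?_⟩
    rw [hiterate, dist_eq_norm, add_sub_cancel_left, ← dist_zero_right]
    exact hstable _ (by rwa [dist_zero_right, ← dist_eq_norm]) n
  · simpa only [hiterate, add_zero] using (hS.attractive (q - c)).const_add c

variable {E : Type*} [NormedAddCommGroup E]

lemma tendsto_seqL2_zero (x : SeqL2 E) (j : ℤ) :
    Tendsto (fun n : ℕ => x (n + j)) atTop (𝓝 0) := by
  have hinjective : Function.Injective fun n : ℕ => (n : ℤ) + j :=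
    (add_left_injective j).comp Nat.cast_injective
  have hsq := (hasSum_norm_sq x).summable.tendsto_cofinite_zero.comp hinjective.tendsto_cofinite
  rw [Nat.cofinite_eq_atTop] at hsq
  simpa [tendsto_zero_iff_norm_tendsto_zero, Function.comp_def] using hsq.sqrt

lemma GloballyAsymptoticallyStable.of_forall_exists_seqL2 {T : E × E → E × E} {C : ℝ}
    (h : ∀ q, ∃ X : SeqL2 E, (∀ n : ℕ, T^[n] q = (X (n + 2), X (n + 1))) ∧ ‖X‖ ≤ C * ‖q‖) :
    GloballyAsymptoticallyStable T 0 := by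
  have hbound (q : E × E) (n : ℕ) : ‖T^[n] q‖ ≤ C * ‖q‖ := by
    obtain ⟨X, hX, hle⟩ := h q
    rw [hX]
    exact (max_le (lp.norm_apply_le_norm two_ne_zero X _)
      (lp.norm_apply_le_norm two_ne_zero X _)).trans hle
  refine ⟨?_, fun ε hε => ⟨ε / (|C| + 1), by positivity, fun q hq n => ?_⟩, fun q => ?_⟩
  · simpa using hbound 0 1
  · rw [dist_zero_right] at hq ⊢
    rw [lt_div_iff₀ (by positivity)] at hq
    linarith [hbound q n, mul_le_mul_of_nonneg_right (le_abs_self C) (norm_nonneg q),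
      norm_nonneg q]
  · obtain ⟨X, hX, -⟩ := h q
    simpa only [hX, Prod.mk_zero_zero]
      using (tendsto_seqL2_zero X 2).prodMk_nhds (tendsto_seqL2_zero X 1)

variable [InnerProductSpace ℝ E] {α β η B K : ℝ} {G : E → E} {x : ℤ → E}

lemma iterate_gradientStep (hx : ∀ k ≥ 2, residual α β η G x k = 0) (n : ℕ) :
    (gradientStep α β η G)^[n] (x 2, x 1) = (x (n + 2), x (n + 1)) := by
  induction n with
  | zero => simp
  | succ n ih =>
    have hstep := hx (n + 2) (by omega)
    rw [residual, output, show (n : ℤ) + 2 - 1 = n + 1 by ring] at hstep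
    rw [Function.iterate_succ_apply', ih, gradientStep, Nat.cast_succ, add_right_comm (n : ℤ) 1 2,
      add_assoc (n : ℤ) 1 1, one_add_one_eq_two, Prod.mk.injEq]
    refine ⟨?_, rfl⟩
    rw [← sub_eq_zero, ← neg_eq_zero, ← hstep]
    module

lemma norm_residual_one_le (hB : 0 ≤ B) (hG : ∀ a, ‖G a‖ ≤ B * ‖a‖) (hx : x 0 = 0) :
    ‖residual α β η G x 1‖ ≤ ‖x 2‖ + (1 + |β| + |α| * (B * (1 + |η|))) * ‖x 1‖ := by
  have hscale (c : ℝ) : ‖x 1 + c • x 1‖ ≤ (1 + |c|) * ‖x 1‖ := by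
    rw [add_mul, one_mul, ← Real.norm_eq_abs, ← norm_smul]
    exact norm_add_le _ _
  have hresidual : residual α β η G x 1
      = x 2 - (x 1 + β • x 1) + α • G (x 1 + η • x 1) := by
    simp only [residual, output, one_add_one_eq_two, sub_self, hx, sub_zero]
    abel
  calc ‖residual α β η G x 1‖
      ≤ ‖x 2‖ + ‖x 1 + β • x 1‖ + |α| * ‖G (x 1 + η • x 1)‖ := by
        rw [hresidual, ← Real.norm_eq_abs, ← norm_smul]
        exact (norm_add_le _ _).trans (add_le_add_left (norm_sub_le _ _) _)
    _ ≤ ‖x 2‖ + (1 + |β|) * ‖x 1‖ + |α| * (B * ((1 + |η|) * ‖x 1‖)) := by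
        gcongr
        · exact hscale β
        · exact (hG _).trans (mul_le_mul_of_nonneg_left (hscale η) hB)
    _ = ‖x 2‖ + (1 + |β| + |α| * (B * (1 + |η|))) * ‖x 1‖ := by ring

lemma exists_orbit (hB : 0 ≤ B) (hG : ∀ a, ‖G a‖ ≤ B * ‖a‖) (q : E × E) :
    ∃ (x : ℤ → E) (r : SeqL2 E), (∀ k ≤ 0, x k = 0) ∧ (∀ k, residual α β η G x k = r k) ∧
      (∀ n : ℕ, (gradientStep α β η G)^[n] q = (x (n + 2), x (n + 1))) ∧
      ‖r‖ ≤ (3 + |β| + |α| * (B * (1 + |η|))) * ‖q‖ := by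
  obtain ⟨x, hstart, hx⟩ := exists_extension α β η G 0
    (fun k => if k = 2 then q.1 else if k = 1 then q.2 else 0) 2
  have hx₀ (k : ℤ) (hk : k ≤ 0) : x k = 0 := by
    rw [hstart k (by omega), if_neg (by omega), if_neg (by omega)]
  have hx₁ : x 1 = q.2 := hstart 1 one_le_two
  have hx₂ : x 2 = q.1 := hstart 2 le_rfl
  have hG₀ : G 0 = 0 := by simpa using hG 0
  let r : SeqL2 E := lp.single 2 0 (x 1) + lp.single 2 1 (residual α β η G x 1)
  have hr (k : ℤ) : r k = (Pi.single 0 (x 1) : ℤ → E) k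
      + (Pi.single 1 (residual α β η G x 1) : ℤ → E) k := rfl
  refine ⟨x, r, hx₀, fun k => ?_, fun n => ?_, ?_⟩
  · rcases (by omega : k < 0 ∨ k = 0 ∨ k = 1 ∨ 2 ≤ k) with hk | rfl | rfl | hk
    · simp [hr, residual, output, hx₀ (k + 1) (by omega), hx₀ k hk.le, hx₀ (k - 1) (by omega), hG₀,
        hk.ne, (hk.trans one_pos).ne]
    · simp [hr, residual, output, hx₀ 0 le_rfl, hx₀ (-1) (by omega), hG₀]
    · simp [hr]
    · simp [hr, hx k hk, show k ≠ 0 by omega, show k ≠ 1 by omega]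
  · rw [← iterate_gradientStep hx, hx₁, hx₂]
  · calc ‖r‖ ≤ ‖x 1‖ + ‖residual α β η G x 1‖ := by
          refine (norm_add_le _ _).trans_eq ?_
          rw [lp.norm_single two_pos, lp.norm_single two_pos]
      _ ≤ ‖x 1‖ + (‖x 2‖ + (1 + |β| + |α| * (B * (1 + |η|))) * ‖x 1‖) := by
          gcongr
          exact norm_residual_one_le hB hG (hx₀ 0 le_rfl)
      _ ≤ ‖q‖ + (‖q‖ + (1 + |β| + |α| * (B * (1 + |η|))) * ‖q‖) := by
          rw [hx₁, hx₂]
          gcongr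
          exacts [norm_snd_le q, norm_fst_le q, norm_snd_le q]
      _ = (3 + |β| + |α| * (B * (1 + |η|))) * ‖q‖ := by ring

theorem L2Stable.globallyAsymptoticallyStable (hK : 0 ≤ K) (hB : 0 ≤ B)
    (hG : ∀ a, ‖G a‖ ≤ B * ‖a‖) (hstab : L2Stable α β η G) (hgain : GainBound α β η K G) :
    GloballyAsymptoticallyStable (gradientStep α β η G) 0 := by
  refine .of_forall_exists_seqL2 (C := K * (3 + |β| + |α| * (B * (1 + |η|)))) fun q => ?_
  obtain ⟨x, r, hx, hr, hiterate, hle⟩ := exists_orbit (α := α) (β := β) (η := η) hB hG q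
  refine ⟨⟨x, hstab x hx (funext hr ▸ lp.memℓp r)⟩, hiterate, (hgain _ r hr).trans ?_⟩
  rw [mul_assoc]
  gcongr

end Stability

section AbsoluteStability

variable {E : Type*} [NormedAddCommGroup E] [InnerProductSpace ℝ E] {α β η m κ L : ℝ}
  {h : ℤ → ℝ}

lemma gradientStep_translate (α β η : ℝ) (G : E → E) (c : E) (q : E × E) :
    gradientStep α β η G ((c, c) + q)
      = (c, c) + gradientStep α β η (fun a => G (c + a)) q := by
  have houtput : c + q.1 + η • (c + q.1 - (c + q.2)) = c + (q.1 + η • (q.1 - q.2)) := by module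
  simp only [gradientStep, Prod.fst_add, Prod.snd_add, Prod.mk_add_mk, Prod.mk.injEq, and_true,
    houtput]
  module

theorem QuadraticBounds.globallyAsymptoticallyStable {F : E → ℝ} {G : E → E}
    (hFG : QuadraticBounds m L F G) (hG : G 0 = 0) (hlip : ∀ a, ‖G a‖ ≤ L * ‖a‖) (hm : 0 < m)
    (hmκ : m ≤ κ) (hκL : κ ≤ L) (hα : α ≠ 0) (hβ : η = β * (1 + η) → |β| < 1)
    (hstable : IsStable (1 - RatFunc.C (κ : ℂ) * transferFunction α β η)⁻¹)
    (hh : IsZamesFalb h) (hFDI : FDI m L h (transferFunction α β η)) :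
    GloballyAsymptoticallyStable (gradientStep α β η G) 0 := by
  have hκ : 0 < κ := hm.trans_le hmκ
  have hL : 0 < L := hκ.trans_le hκL
  obtain ⟨J, h', c, h₀, h₁, hc, hfreq⟩ := hFDI.exists_uniform hα (mul_pos hm hL) hβ hh
  obtain ⟨K, hK, hgain⟩ := exists_gainBound (E := E) hα (hmκ.trans hκL) h₀ h₁ hc hfreq
  have hlinear : L2Stable α β η fun a : E => κ • a :=
    .of_linear fun _ => norm_lt_one_of_isRoot_closedLoopPoly hα hκ.ne' hβ hstable
  have hnonlinear : L2Stable α β η G := by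
    refine hlinear.homotopy hK (add_pos hL hκ).le (fun t ht => ?_) fun a => ?_
    · exact hgain _ _ ((QuadraticBounds.quadratic hmκ hκL).combination hFG ht.1 ht.2) (by simp [hG])
    · refine (norm_sub_le _ _).trans ?_
      rw [norm_smul, Real.norm_of_nonneg hκ.le, add_mul]
      gcongr
      exact hlip a
  exact hnonlinear.globallyAsymptoticallyStable hK hL.le hlip (hgain F G hFG hG)

end AbsoluteStability

end GradAlg

theorem mainTheorem3_general {E : Type*} [NormedAddCommGroup E] [InnerProductSpace ℝ E]
    [CompleteSpace E] {α β η m κ L : ℝ} (hm : 0 < m) (hmκ : m ≤ κ) (hκL : κ ≤ L)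
    (hα : α ≠ 0) (hβ : η = β * (1 + η) → |β| < 1)
    (hstable : GradAlg.IsStable
      (1 - RatFunc.C (κ : ℂ) * GradAlg.transferFunction α β η)⁻¹)
    {h : ℤ → ℝ} (hh : GradAlg.IsZamesFalb h)
    (hFDI : GradAlg.FDI m L h (GradAlg.transferFunction α β η))
    {f : E → ℝ} (hf : Differentiable ℝ f) (hlip : ∀ x y, ‖∇ f x - ∇ f y‖ ≤ L * ‖x - y‖)
    (hconvex : StrongConvexOn Set.univ m f) :
    ∃ xs : E, (∀ x, x ≠ xs → f xs < f x) ∧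
      GradAlg.GloballyAsymptoticallyStable (GradAlg.gradientStep α β η (∇ f)) (xs, xs) := by
  have hbounds := GradAlg.quadraticBounds_gradient hf hlip hconvex
  obtain ⟨xs, hxs⟩ := GradAlg.exists_eq_zero_of_strongly_monotone hm
    (hm.trans_le (hmκ.trans hκL)) hbounds.mul_norm_sub_sq_le_inner hlip
  refine ⟨xs, fun x hx => hbounds.lt_of_eq_zero hm hxs hx, ?_⟩
  have hzero : GradAlg.GloballyAsymptoticallyStable
      (GradAlg.gradientStep α β η fun a => ∇ f (xs + a)) 0 :=
    (hbounds.translate xs).globallyAsymptoticallyStable (by rw [add_zero, hxs])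
      (fun a => by simpa [hxs] using hlip (xs + a) xs) hm hmκ hκL hα hβ hstable hh hFDI
  exact hzero.of_translate fun q => GradAlg.gradientStep_translate α β η (∇ f) xs q

/-- The hypotheses `hα` and `hβ` say that the realization of `g` by the algorithm has no hidden
mode on or outside the unit circle; they hold whenever this realization is minimal. -/
theorem mainTheorem3 (α β η m L : ℝ) (hm : 0 < m) (hmL : m ≤ L)
    (hα : α ≠ 0) (hβ : η = β * (1 + η) → |β| < 1)
    (hstable : GradAlg.IsStable
      (1 - RatFunc.C (((L + m) / 2 : ℝ) : ℂ) * GradAlg.transferFunction α β η)⁻¹)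
    (h : ℤ → ℝ) (hh : GradAlg.IsZamesFalb h)
    (hFDI : GradAlg.FDI m L h (GradAlg.transferFunction α β η))
    (d : ℕ) (f : EuclideanSpace ℝ (Fin d) → ℝ) (hf : GradAlg.SmoothStronglyConvex m L f) :
    ∃ xs : EuclideanSpace ℝ (Fin d), (∀ x, x ≠ xs → f xs < f x) ∧
      GradAlg.GloballyAsymptoticallyStable (GradAlg.step α β η f) (xs, xs) :=
  mainTheorem3_general hm (by linarith) (by linarith) hα hβ hstable hh hFDI hf.differentiable
    hf.lipschitz_gradient hf.strongConvex
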